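/- For $n\ge 1$ let $h_n=\sum_{i=1}^{n}\frac1{2i-1}$, and for $n\ge 0$ let $t_n(1)=\sum_{m=0}^{n}\frac{1}{m+\frac12}$ (Milgram constants). Let $\psi^{(0)}=\Gamma'/\Gamma$ and $\psi^{(1)}=(\psi^{(0)})'$ be the digamma and trigamma functions, $H_x=\psi^{(0)}(x+1)+\gamma$ the harmonic number of real index $x>-1$ ($\gamma$ is Euler's constant), $G=\sum_{n\ge0}\frac{(-1)^n}{(2n+1)^2}$ the Catalan constant, $\zeta$ the Riemann zeta function, and $W(3)=\operatorname{Im}\mathrm{Li}_3\!\left(\frac{1+i}{2}\right)$ with $\mathrm{Li}_3(z)=\sum_{m\ge1}\frac{z^m}{m^3}$. Then for every integer $k\ge 0$ all the following series converge absolutely, and \begin{align*} \sum_{n=1}^{\infty}\frac{(-1)^{n}h_{n}}{n(2n+2k+1)^{2}} ={}&\sum_{n=0}^{\infty}\frac{(-1)^{n+1}t_{n}(1)}{2(n+1)(2n+2k+3)^{2}}\\ ={}&\frac{1}{2k+1}\Bigg\{-\frac{\pi^2}{16}+\frac{k}{2k+1}\Bigg(\frac{\pi^2}{8}-(-1)^{k}2G+\frac{(-1)^{k}\pi\ln2}{2}-\sum_{j=1}^{k}(-1)^{j+1}\frac{\pi+H_{\frac{2k-2j-1}{4}}-H_{\frac{2k-2j+1}{4}}}{2+2k-2j}\Bigg)\\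 &-2\Bigg[\sum_{j=1}^{k}\frac{(-1)^{j+1}}{64(k+1-j)^{2}}\Bigg(-4\pi+4\psi^{(0)}\!\left(\tfrac{2k+5-2j}{4}\right)-4\psi^{(0)}\!\left(\tfrac{2k+3-2j}{4}\right)\\ &\qquad-2(k+1-j)\Big(\psi^{(1)}\!\left(\tfrac{2k+5-2j}{4}\right)-\psi^{(1)}\!\left(\tfrac{2k+3-2j}{4}\right)\Big)\Bigg)+\frac{(-1)^{k}}{96}\left(3\pi^{3}+6\pi(\ln2)^2-192W(3)\right)\Bigg]\\ &+2\Bigg[\sum_{j=1}^{k}(-1)^{j+1}\frac{\pi+H_{\frac{2k-1-2j}{4}}-H_{\frac{2k+1-2j}{4}}}{8(k+1-j)}+\frac{(-1)^{k}}{8}(4G-\pi\ln2)\Bigg]\Bigg\}, \end{align*} \begin{align*} \sum_{n=1}^{\infty}\frac{(-1)^{n}h_{n}}{n(2n+2k+2)^{2}} ={}&\sum_{n=0}^{\infty}\frac{(-1)^{n+1}t_{n}(1)}{2(n+1)(2n+2k+4)^{2}}\\ ={}&\frac{1}{2(k+1)}\Bigg\{-\frac{\pi^2}{16}+\frac{2k+1}{4(k+1)}\Bigg(\frac{\pi^2}{8}-\sum_{j=1}^{k+1}(-1)^{j+1}\frac{\pi+H_{\frac{k-j}{2}}-H_{\frac{k-j+1}{2}}}{2k-2j+3}-\frac{(-1)^{k+1}\pi^{2}}{8}\Bigg)\\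 &-2\Bigg[\sum_{j=1}^{k+1}\frac{(-1)^{j+1}}{16(2k+3-2j)^{2}}\Bigg(-4\pi+4\psi^{(0)}\!\left(\tfrac{k+3-j}{2}\right)-4\psi^{(0)}\!\left(\tfrac{k+2-j}{2}\right)\\ &\qquad-(2k+3-2j)\Big(\psi^{(1)}\!\left(\tfrac{k+3-j}{2}\right)-\psi^{(1)}\!\left(\tfrac{k+2-j}{2}\right)\Big)\Bigg)+\frac{(-1)^{k+1}}{16}(-4\pi G+7\zeta(3))\Bigg]\\ &+2\Bigg[\sum_{j=1}^{k+1}(-1)^{j+1}\frac{\pi+H_{\frac{k-j}{2}}-H_{\frac{k+1-j}{2}}}{4(2k+3-2j)}+\frac{(-1)^{k+1}\pi^2}{32}\Bigg]\Bigg\}. \end{align*} -/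

import Mathlib

namespace EulerLike

open Finset

/-- The odd harmonic number `h_n = ∑_{k=1}^n 1/(2k-1)`. -/
noncomputable def oddHarmonic (n : ℕ) : ℝ :=
  ∑ k ∈ Icc 1 n, 1 / (2 * (k : ℝ) - 1)

/-- The Milgram constant `t_k(n)`, written `milgram n k`: the nested sum
`∑_{m_n=0}^k 1/(m_n + n/2) ∑_{m_{n-1}=0}^{m_n} 1/(m_{n-1} + (n-1)/2) ⋯ ∑_{m_1=0}^{m_2} 1/(m_1 + 1/2)`
(the empty nested sum, `n = 0`, is `1`). -/
noncomputable def milgram : ℕ → ℕ → ℝ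
  | 0, _ => 1
  | n + 1, k => ∑ m ∈ range (k + 1), 1 / ((m : ℝ) + ((n : ℝ) + 1) / 2) * milgram n m

/-- The polygamma function `ψ^{(n)}` on the reals: the `n`-th derivative of `ψ = Γ'/Γ`. -/
noncomputable def polygamma (n : ℕ) (x : ℝ) : ℝ :=
  iteratedDeriv n (logDeriv Real.Gamma) x

/-- The harmonic number `H_x = ψ(x + 1) + γ` with real index `x > -1`. -/
noncomputable def harmonicReal (x : ℝ) : ℝ :=
  polygamma 0 (x + 1) + Real.eulerMascheroniConstant

/-- The Catalan constant `G = ∑_{n≥0} (-1)^n/(2n+1)^2`. -/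
noncomputable def catalanG : ℝ :=
  ∑' n : ℕ, (-1 : ℝ) ^ n / (2 * (n : ℝ) + 1) ^ 2

/-- The polylogarithm `Li_s(z) = ∑_{k≥1} z^k/k^s`, used for `|z| ≤ 1` and `s ≥ 2`. -/
noncomputable def polylog (s : ℕ) (z : ℂ) : ℂ :=
  ∑' k : ℕ, z ^ (k + 1) / ((k : ℂ) + 1) ^ s

/-- `W(3) = Im Li₃((1+i)/2)`. -/
noncomputable def W3 : ℝ :=
  (polylog 3 ((1 + Complex.I) / 2)).im

/-- `ζ(3)` as a real number. -/
noncomputable def zeta3 : ℝ := (riemannZeta 3).re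

/-- The closed form of `∑_{n≥1} (-1)^n h_n / (n (2n+2k+1)^2)`. -/
noncomputable def closedFormOdd (k : ℕ) : ℝ :=
  1 / (2 * (k : ℝ) + 1) *
    (-(Real.pi ^ 2 / 16)
      + (k : ℝ) / (2 * (k : ℝ) + 1) *
        (Real.pi ^ 2 / 8 - (-1) ^ k * (2 * catalanG)
          + (-1) ^ k * Real.pi * Real.log 2 / 2
          - ∑ j ∈ Icc 1 k, (-1) ^ (j + 1) *
              ((Real.pi + harmonicReal ((2 * (k : ℝ) - 2 * (j : ℝ) - 1) / 4)
                  - harmonicReal ((2 * (k : ℝ) - 2 * (j : ℝ) + 1) / 4))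
                / (2 + 2 * (k : ℝ) - 2 * (j : ℝ))))
      - 2 *
        ((∑ j ∈ Icc 1 k, (-1) ^ (j + 1) / (64 * ((k : ℝ) + 1 - (j : ℝ)) ^ 2) *
            (-(4 * Real.pi)
              + 4 * polygamma 0 ((2 * (k : ℝ) + 5 - 2 * (j : ℝ)) / 4)
              - 4 * polygamma 0 ((2 * (k : ℝ) + 3 - 2 * (j : ℝ)) / 4)
              - 2 * ((k : ℝ) + 1 - (j : ℝ)) *
                (polygamma 1 ((2 * (k : ℝ) + 5 - 2 * (j : ℝ)) / 4)
                  - polygamma 1 ((2 * (k : ℝ) + 3 - 2 * (j : ℝ)) / 4))))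
          + (-1) ^ k / 96 *
            (3 * Real.pi ^ 3 + 6 * Real.pi * Real.log 2 ^ 2 - 192 * W3))
      + 2 *
        ((∑ j ∈ Icc 1 k, (-1) ^ (j + 1) *
            ((Real.pi + harmonicReal ((2 * (k : ℝ) - 1 - 2 * (j : ℝ)) / 4)
                - harmonicReal ((2 * (k : ℝ) + 1 - 2 * (j : ℝ)) / 4))
              / (8 * ((k : ℝ) + 1 - (j : ℝ)))))
          + (-1) ^ k / 8 * (4 * catalanG - Real.pi * Real.log 2)))

/-- The closed form of `∑_{n≥1} (-1)^n h_n / (n (2n+2k+2)^2)`. -/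
noncomputable def closedFormEven (k : ℕ) : ℝ :=
  1 / (2 * ((k : ℝ) + 1)) *
    (-(Real.pi ^ 2 / 16)
      + (2 * (k : ℝ) + 1) / (4 * ((k : ℝ) + 1)) *
        (Real.pi ^ 2 / 8
          - (∑ j ∈ Icc 1 (k + 1), (-1) ^ (j + 1) *
              ((Real.pi + harmonicReal (((k : ℝ) - (j : ℝ)) / 2)
                  - harmonicReal (((k : ℝ) - (j : ℝ) + 1) / 2))
                / (2 * (k : ℝ) - 2 * (j : ℝ) + 3)))
          - (-1) ^ (k + 1) * Real.pi ^ 2 / 8)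
      - 2 *
        ((∑ j ∈ Icc 1 (k + 1),
            (-1) ^ (j + 1) / (16 * (2 * (k : ℝ) + 3 - 2 * (j : ℝ)) ^ 2) *
            (-(4 * Real.pi)
              + 4 * polygamma 0 (((k : ℝ) + 3 - (j : ℝ)) / 2)
              - 4 * polygamma 0 (((k : ℝ) + 2 - (j : ℝ)) / 2)
              - (2 * (k : ℝ) + 3 - 2 * (j : ℝ)) *
                (polygamma 1 (((k : ℝ) + 3 - (j : ℝ)) / 2)
                  - polygamma 1 (((k : ℝ) + 2 - (j : ℝ)) / 2))))
          + (-1) ^ (k + 1) / 16 * (-(4 * catalanG * Real.pi) + 7 * zeta3))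
      + 2 *
        ((∑ j ∈ Icc 1 (k + 1), (-1) ^ (j + 1) *
            ((Real.pi + harmonicReal (((k : ℝ) - (j : ℝ)) / 2)
                - harmonicReal (((k : ℝ) + 1 - (j : ℝ)) / 2))
              / (4 * (2 * (k : ℝ) + 3 - 2 * (j : ℝ)))))
          + (-1) ^ (k + 1) * Real.pi ^ 2 / 32))

end EulerLike

namespace EulerLike

open Filter Topology MeasureTheory intervalIntegral Set

/-! Squaring the arctangent series gives `arctan² x = ∑ (-1)^(n-1) h_n x^(2n) / n`, and `∫₀¹ x^p log
x = -1/(p+1)²`. Hence each series equals `∫₀¹ x^m arctan² x log x` with `m = 2k` or `m = 2k+1`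
(`hasSum_oddHarmonic_moment`). The Milgram version is the same series, since `t_n(1) = 2 h_(n+1)`.

Integration by parts (`integral_pow_mul_log_mul_arctan_sq`) reduces this integral to `A(a) = ∫₀¹ x^a
arctan x / (1+x²)` (`arctanMoment`) and `L(a) = ∫₀¹ x^a arctan x log x / (1+x²)` (`logArctanMoment`)
at `a = m+1`. Because `x^(a+2) + x^a = x^a (1+x²)`, both satisfy `u(a+2) = v(a) - u(a)`, where
`v(a)` is an elementary moment of arctan, evaluated through digamma and trigamma values. Iterating
(`eq_sum_of_add_two_eq_sub`) produces the finite sums over `j` and leaves `A(0)`, `A(1)`, `L(0)`,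
`L(1)`.

`A(0)` is immediate. The others use `z = (1+ix)/(1-ix)`, for which `dz/z = 2i dx/(1+x²)`, so
integrals against `dx/(1+x²)` become integrals over the arc from `1` to `i`. There `log(1+z)` and
`log(1-z)` are explicit in `log x`, `log(1+x²)` and `arctan x`. The antiderivatives are
polylogarithms; one works on the arc of radius `r < 1` and lets `r → 1` by dominated convergence.
This gives `A(1)` from `Li₂`, and `L(0)` from `χ₂`, `χ₃`.

For `L(1)`, parts leave `J = ∫ log(1+x²) log x / (1+x²)` and `K = ∫ arctan x log(1+x²) / x`.
Cauchy's theorem in a quarter disc, applied to `log((1-z)/(1+z)) log(1+z) / z`, relates `J` to `K`;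
Landen's transformation of `Li₂` and `Li₃` along the imaginary axis evaluates `K`, and its endpoint
`i/(1+i) = (1+i)/2` is the source of `W(3)`. -/

theorem _root_.HasSum.of_eq {ι α : Type*} [AddCommMonoid α] [TopologicalSpace α] {f g : ι → α}
    {a b : α} (h : HasSum f a) (hf : ∀ i, g i = f i) (ha : b = a) : HasSum g b := by
  rw [ha, funext hf]
  exact h

/-! ### Digamma and trigamma series -/

theorem differentiableAt_Gamma_of_pos {x : ℝ} (hx : 0 < x) : DifferentiableAt ℝ Real.Gamma x :=
  Real.differentiableAt_Gamma fun m => by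
    have : (0 : ℝ) ≤ m := m.cast_nonneg
    linarith

theorem logDeriv_Gamma_add_one {x : ℝ} (hx : 0 < x) :
    logDeriv Real.Gamma (x + 1) = logDeriv Real.Gamma x + 1 / x := by
  have h1 : (fun y : ℝ => Real.Gamma (y + 1)) =ᶠ[𝓝 x] fun y => y * Real.Gamma y := by
    filter_upwards [lt_mem_nhds hx] with y hy
    exact Real.Gamma_add_one hy.ne'
  have h2 := h1.deriv_eq
  rw [deriv_comp_add_const, deriv_fun_mul differentiableAt_fun_id (differentiableAt_Gamma_of_pos hx)]
    at h2
  have h3 := (Real.Gamma_pos_of_pos hx).ne'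
  simp only [logDeriv_apply, h2, Real.Gamma_add_one hx.ne', deriv_id'']
  simp
  field_simp
  ring

theorem logDeriv_Gamma_add_nat {x : ℝ} (hx : 0 < x) (m : ℕ) :
    logDeriv Real.Gamma (x + m) = logDeriv Real.Gamma x + ∑ i ∈ Finset.range m, 1 / ((i : ℝ) + x) := by
  induction m with
  | zero => simp
  | succ m ih =>
    rw [Finset.sum_range_succ, Nat.cast_succ, ← add_assoc, logDeriv_Gamma_add_one (by positivity),
      ih, add_comm x (m : ℝ)]
    ring

theorem monotoneOn_logDeriv_Gamma : MonotoneOn (logDeriv Real.Gamma) (Ioi 0) := by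
  have h := Real.convexOn_log_Gamma.monotoneOn_deriv fun x hx =>
    (differentiableAt_Gamma_of_pos hx).log (Real.Gamma_pos_of_pos hx).ne'
  refine h.congr fun x hx => ?_
  exact Real.deriv_log_comp_eq_logDeriv (differentiableAt_Gamma_of_pos hx)
    (Real.Gamma_pos_of_pos hx).ne'

/-- The functional equation turns the partial sums into `ψ(x) - ψ(y) - (ψ(x+N) - ψ(y+N))`. The
remainder tends to `0` because `ψ` is increasing (log-convexity of Gamma). -/
theorem hasSum_logDeriv_Gamma_sub_of_le {x y : ℝ} (hy : 0 < y) (hxy : y ≤ x) :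
    HasSum (fun n : ℕ => 1 / ((n : ℝ) + y) - 1 / ((n : ℝ) + x))
      (logDeriv Real.Gamma x - logDeriv Real.Gamma y) := by
  have hx : 0 < x := hy.trans_le hxy
  rw [hasSum_iff_tendsto_nat_of_nonneg]
  -- With `x ≤ y + m`, monotonicity bounds the remainder by `ψ(y+N+m) - ψ(y+N)`, a sum of `m`
  -- reciprocals each tending to `0`.
  · obtain ⟨m, hm⟩ := exists_nat_ge (x - y)
    have hlim : Tendsto (fun N : ℕ => ∑ i ∈ Finset.range m, 1 / ((i : ℝ) + (y + N))) atTop (𝓝 0) := by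
      rw [← Finset.sum_const_zero (s := Finset.range m)]
      refine tendsto_finsetSum _ fun i _ => ?_
      refine tendsto_const_nhds.div_atTop (tendsto_atTop_add_const_left _ _
        (tendsto_atTop_add_const_left _ _ tendsto_natCast_atTop_atTop))
    have hsq : Tendsto (fun N : ℕ => logDeriv Real.Gamma (x + N) - logDeriv Real.Gamma (y + N))
        atTop (𝓝 0) := by
      refine squeeze_zero (fun N => ?_) (fun N => ?_) hlim
      · exact sub_nonneg.2 (monotoneOn_logDeriv_Gamma (by simp; positivity)
          (by simp; positivity) (by linarith))
      · rw [sub_le_iff_le_add', ← logDeriv_Gamma_add_nat (by positivity)]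
        exact monotoneOn_logDeriv_Gamma (by simp; positivity) (by simp; positivity) (by linarith)
    have := hsq.const_sub (logDeriv Real.Gamma x - logDeriv Real.Gamma y)
    rw [sub_zero] at this
    refine this.congr fun N => ?_
    rw [logDeriv_Gamma_add_nat hx, logDeriv_Gamma_add_nat hy, Finset.sum_sub_distrib]
    ring
  · intro n
    exact sub_nonneg.2 (one_div_le_one_div_of_le (by positivity) (by linarith))

theorem hasSum_polygamma_zero_sub {x y : ℝ} (hx : 0 < x) (hy : 0 < y) :
    HasSum (fun n : ℕ => 1 / ((n : ℝ) + y) - 1 / ((n : ℝ) + x))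
      (polygamma 0 x - polygamma 0 y) := by
  simp only [polygamma, iteratedDeriv_zero]
  rcases le_total y x with h | h
  · exact hasSum_logDeriv_Gamma_sub_of_le hy h
  · simpa using (hasSum_logDeriv_Gamma_sub_of_le hx h).neg

theorem summable_one_div_nat_add_sq {c : ℝ} (hc : 0 < c) :
    Summable fun n : ℕ => 1 / ((n : ℝ) + c) ^ 2 := by
  refine ((Real.summable_one_div_nat_add_rpow c 2).2 (by norm_num)).congr fun n => ?_
  rw [abs_of_pos (by positivity), Real.rpow_two]

/-- Termwise differentiation of the series for `ψ(z) - ψ(1)`, on `z > x/2`, where the derivatives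
are dominated by `1/(n + x/2)²`. -/
theorem hasSum_polygamma_one {x : ℝ} (hx : 0 < x) :
    HasSum (fun n : ℕ => 1 / ((n : ℝ) + x) ^ 2) (polygamma 1 x) := by
  have hx2 : 0 < x / 2 := by positivity
  have hd : HasDerivAt (fun z => ∑' n : ℕ, (1 / ((n : ℝ) + 1) - 1 / ((n : ℝ) + z)))
      (∑' n : ℕ, 1 / ((n : ℝ) + x) ^ 2) x := by
    refine hasDerivAt_tsum_of_isPreconnected (t := Ioi (x / 2))
      (g' := fun (n : ℕ) z => 1 / ((n : ℝ) + z) ^ 2)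
      (summable_one_div_nat_add_sq hx2) isOpen_Ioi isPreconnected_Ioi ?_ ?_
      (y₀ := x) (by simp; linarith) (hasSum_polygamma_zero_sub hx one_pos).summable
      (by simp; linarith)
    · intro n y hy
      have hy : 0 < y := hx2.trans hy
      have h := (((hasDerivAt_id y).const_add (n : ℝ)).fun_inv (by simp; positivity)).const_sub
        (1 / ((n : ℝ) + 1))
      simp only [one_div]
      convert h using 1
      · simp
      · simp [neg_div]
    · intro n y hy
      have hy' : 0 < y := hx2.trans hy
      have : x / 2 ≤ y := le_of_lt hy
      rw [Real.norm_of_nonneg (by positivity)]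
      gcongr
  have he : (fun z => ∑' n : ℕ, (1 / ((n : ℝ) + 1) - 1 / ((n : ℝ) + z)))
      =ᶠ[𝓝 x] fun z => logDeriv Real.Gamma z - logDeriv Real.Gamma 1 := by
    filter_upwards [lt_mem_nhds hx] with z hz
    exact (hasSum_polygamma_zero_sub hz one_pos).tsum_eq
  have h1 := (hd.congr_of_eventuallyEq he.symm).deriv
  rw [deriv_sub_const] at h1
  rw [polygamma, iteratedDeriv_one, h1]
  exact (summable_one_div_nat_add_sq hx).hasSum

/-! ### Term-by-term integration over the unit interval -/

theorem intervalIntegrable_mul_log {f : ℝ → ℝ} (hf : Continuous f) :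
    IntervalIntegrable (fun x => f x * Real.log x) volume 0 1 :=
  intervalIntegrable_log'.continuousOn_mul hf.continuousOn

theorem continuous_pow_succ_mul_log (m : ℕ) :
    Continuous fun x : ℝ => x ^ (m + 1) * Real.log x := by
  have := (continuous_pow (M := ℝ) m).mul Real.continuous_mul_log
  refine this.congr fun x => ?_
  simp only [Pi.mul_apply]
  ring

theorem hasDerivAt_logPrimitive (m : ℕ) {x : ℝ} (hx : x ≠ 0) :
    HasDerivAt (fun x : ℝ => x ^ (m + 1) * Real.log x / (m + 1) - x ^ (m + 1) / ((m : ℝ) + 1) ^ 2)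
      (x ^ m * Real.log x) x := by
  have hm : (m : ℝ) + 1 ≠ 0 := by positivity
  have h := (((hasDerivAt_pow (m + 1) x).fun_mul (Real.hasDerivAt_log hx)).div_const
    ((m : ℝ) + 1)).fun_sub ((hasDerivAt_pow (m + 1) x).div_const (((m : ℝ) + 1) ^ 2))
  refine h.congr_deriv ?_
  simp
  field_simp
  ring

theorem continuous_logPrimitive (m : ℕ) :
    Continuous fun x : ℝ => x ^ (m + 1) * Real.log x / (m + 1) - x ^ (m + 1) / ((m : ℝ) + 1) ^ 2 :=
  ((continuous_pow_succ_mul_log m).div_const _).sub ((continuous_pow _).div_const _)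

theorem integral_pow_mul_log (m : ℕ) :
    ∫ x in (0 : ℝ)..1, x ^ m * Real.log x = -(1 / ((m : ℝ) + 1) ^ 2) := by
  rw [integral_eq_sub_of_hasDerivAt_of_le zero_le_one (continuous_logPrimitive m).continuousOn
    (fun x hx => hasDerivAt_logPrimitive m hx.1.ne')
    (intervalIntegrable_mul_log (continuous_pow m))]
  simp

/-- The pointwise sum is required only on the open interval, since the geometric expansions used
later break down at `x = 1`. -/
theorem hasSum_integral_unit {F : ℕ → ℝ → ℝ} {f : ℝ → ℝ}
    (hF : ∀ n, IntervalIntegrable (F n) volume 0 1)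
    (hs : Summable fun n => ∫ x in (0 : ℝ)..1, |F n x|)
    (hf : ∀ x ∈ Ioo (0 : ℝ) 1, HasSum (fun n => F n x) (f x)) :
    HasSum (fun n => ∫ x in (0 : ℝ)..1, F n x) (∫ x in (0 : ℝ)..1, f x) := by
  simp only [integral_of_le (zero_le_one' ℝ), integral_Ioc_eq_integral_Ioo] at hs ⊢
  have h := hasSum_integral_of_summable_integral_norm (μ := volume.restrict (Ioo (0 : ℝ) 1))
    (F := F) (fun n => ((intervalIntegrable_iff_integrableOn_Ioo_of_le zero_le_one).1 (hF n))) hs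
  exact h.of_eq (fun _ => rfl)
    (setIntegral_congr_fun measurableSet_Ioo fun x hx => (hf x hx).tsum_eq.symm)

/-- As `log x` keeps a constant sign on the interval, the integrals of absolute values are explicit
too, so summability becomes a condition on `c` and `e` alone. -/
theorem hasSum_integral_pow_mul_log {c : ℕ → ℝ} {e : ℕ → ℕ} {f : ℝ → ℝ}
    (hs : Summable fun n => |c n| / ((e n : ℝ) + 1) ^ 2)
    (hf : ∀ x ∈ Ioo (0 : ℝ) 1, HasSum (fun n => c n * x ^ e n * Real.log x) (f x)) :
    HasSum (fun n => -(c n / ((e n : ℝ) + 1) ^ 2)) (∫ x in (0 : ℝ)..1, f x) := by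
  have hI : ∀ n, ∫ x in (0 : ℝ)..1, c n * x ^ e n * Real.log x = -(c n / ((e n : ℝ) + 1) ^ 2) := by
    intro n
    simp only [mul_assoc, intervalIntegral.integral_const_mul, integral_pow_mul_log]
    ring
  have h := hasSum_integral_unit (F := fun n x => c n * x ^ e n * Real.log x)
    (fun n => intervalIntegrable_mul_log (by fun_prop)) ?_ hf
  · simpa only [hI] using h
  · refine hs.congr fun n => ?_
    have : ∫ x in (0 : ℝ)..1, |c n * x ^ e n * Real.log x|
        = ∫ x in (0 : ℝ)..1, -|c n| * (x ^ e n * Real.log x) := by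
      refine integral_congr fun x hx => ?_
      rw [uIcc_of_le zero_le_one] at hx
      simp only [abs_mul, abs_of_nonneg (pow_nonneg hx.1 _),
        abs_of_nonpos (Real.log_nonpos hx.1 hx.2)]
      ring
    rw [this, intervalIntegral.integral_const_mul, integral_pow_mul_log]
    ring

/-! ### The integrals `∫ x^b / (1+x²)` and `∫ x^b log x / (1+x²)` -/

theorem one_add_sq_ne_zero (x : ℝ) : 1 + x ^ 2 ≠ 0 := by positivity

theorem continuous_inv_one_add_sq : Continuous fun x : ℝ => (1 + x ^ 2)⁻¹ :=
  Continuous.inv₀ (by fun_prop) one_add_sq_ne_zero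

theorem hasSum_integral_pow_mul_log_div (b : ℕ) :
    HasSum (fun n : ℕ => -((-1) ^ n / (2 * (n : ℝ) + b + 1) ^ 2))
      (∫ x in (0 : ℝ)..1, x ^ b * Real.log x / (1 + x ^ 2)) := by
  have h := hasSum_integral_pow_mul_log (c := fun n => (-1) ^ n) (e := fun n => 2 * n + b)
    (f := fun x => x ^ b * Real.log x / (1 + x ^ 2)) ?_ ?_
  · simpa using h
  · refine (summable_one_div_nat_add_sq (c := 1) one_pos).of_nonneg_of_le
      (fun n => by positivity) fun n => ?_
    simp only [abs_pow, abs_neg, abs_one, one_pow]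
    push_cast
    have : (0 : ℝ) ≤ n := n.cast_nonneg
    have : (0 : ℝ) ≤ b := b.cast_nonneg
    gcongr
    linarith
  · intro x hx
    have h1 : HasSum (fun n : ℕ => (-x ^ 2) ^ n) (1 - -x ^ 2)⁻¹ := by
      refine hasSum_geometric_of_abs_lt_one ?_
      rw [abs_neg, abs_of_nonneg (by positivity)]
      exact pow_lt_one₀ hx.1.le hx.2 two_ne_zero
    refine (h1.mul_left (x ^ b * Real.log x)).of_eq (fun n => ?_) ?_
    · rw [neg_pow (x ^ 2), ← pow_mul, pow_add]
      ring
    · rw [sub_neg_eq_add, div_eq_mul_inv]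

theorem integral_pow_mul_log_div (b : ℕ) :
    ∫ x in (0 : ℝ)..1, x ^ b * Real.log x / (1 + x ^ 2)
      = (polygamma 1 (((b : ℝ) + 3) / 4) - polygamma 1 (((b : ℝ) + 1) / 4)) / 16 := by
  refine (hasSum_integral_pow_mul_log_div b).unique ?_
  have h1 := (hasSum_polygamma_one (x := ((b : ℝ) + 1) / 4) (by positivity)).mul_left (-(1 / 16))
  have h2 := (hasSum_polygamma_one (x := ((b : ℝ) + 3) / 4) (by positivity)).mul_left (1 / 16)
  -- Even and odd indices separate the alternating series into two trigamma series of step `4`.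
  refine (HasSum.even_add_odd (f := fun n : ℕ => -((-1) ^ n / (2 * (n : ℝ) + b + 1) ^ 2))
    (h1.of_eq (fun n => ?_) rfl) (h2.of_eq (fun n => ?_) rfl)).of_eq (fun _ => rfl) (by ring)
  · have : (n : ℝ) + (b + 1) / 4 ≠ 0 := by positivity
    have : 2 * (2 * (n : ℝ)) + b + 1 ≠ 0 := by positivity
    simp only [pow_mul, neg_one_sq, one_pow]
    push_cast
    field_simp
    ring
  · have : (n : ℝ) + (b + 3) / 4 ≠ 0 := by positivity
    have : 2 * (2 * (n : ℝ) + 1) + b + 1 ≠ 0 := by positivity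
    simp only [pow_mul, pow_succ]
    push_cast
    field_simp
    ring

theorem integral_log_div : ∫ x in (0 : ℝ)..1, Real.log x / (1 + x ^ 2) = -catalanG := by
  have h := (hasSum_integral_pow_mul_log_div 0).tsum_eq
  simp only [pow_zero, one_mul, Nat.cast_zero, add_zero, tsum_neg] at h
  exact h.symm

/-- The plain geometric expansion integrates to a series that is only conditionally convergent.
Pairing consecutive terms, `x^b/(1+x²) = ∑ x^(4n+b) (1-x²)`, makes all terms nonnegative and yields
a digamma difference. -/
theorem integral_pow_div (b : ℕ) :
    ∫ x in (0 : ℝ)..1, x ^ b / (1 + x ^ 2)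
      = (polygamma 0 (((b : ℝ) + 3) / 4) - polygamma 0 (((b : ℝ) + 1) / 4)) / 4 := by
  have hψ := (hasSum_polygamma_zero_sub (x := ((b : ℝ) + 3) / 4) (y := ((b : ℝ) + 1) / 4)
    (by positivity) (by positivity)).div_const 4
  have hI : ∀ n : ℕ, ∫ x in (0 : ℝ)..1, (x ^ (4 * n + b) - x ^ (4 * n + b + 2))
      = (1 / ((n : ℝ) + (b + 1) / 4) - 1 / ((n : ℝ) + (b + 3) / 4)) / 4 := by
    intro n
    rw [intervalIntegral.integral_sub (Continuous.intervalIntegrable (by fun_prop) _ _)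
      (Continuous.intervalIntegrable (by fun_prop) _ _), integral_pow, integral_pow]
    have : (n : ℝ) + (b + 1) / 4 ≠ 0 := by positivity
    have : (n : ℝ) + (b + 3) / 4 ≠ 0 := by positivity
    have : 4 * (n : ℝ) + b + 1 ≠ 0 := by positivity
    have : 4 * (n : ℝ) + b + 2 + 1 ≠ 0 := by positivity
    simp
    field_simp
    ring
  have h := hasSum_integral_unit (F := fun n x => x ^ (4 * n + b) - x ^ (4 * n + b + 2))
    (f := fun x => x ^ b / (1 + x ^ 2))
    (fun n => Continuous.intervalIntegrable (by fun_prop) _ _) ?_ ?_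
  · simp only [hI] at h
    exact h.unique hψ
  · refine (hψ.summable).congr fun n => ?_
    rw [← hI]
    refine integral_congr fun x hx => ?_
    rw [uIcc_of_le zero_le_one] at hx
    exact (abs_of_nonneg (sub_nonneg.2 (pow_le_pow_of_le_one hx.1 hx.2 (by omega)))).symm
  · intro x hx
    have h1 : HasSum (fun n : ℕ => (x ^ 4) ^ n) (1 - x ^ 4)⁻¹ :=
      hasSum_geometric_of_lt_one (pow_nonneg hx.1.le _) (pow_lt_one₀ hx.1.le hx.2 (by norm_num))
    refine (h1.mul_left (x ^ b * (1 - x ^ 2))).of_eq (fun n => ?_) ?_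
    · rw [← pow_mul, pow_add, pow_add, pow_add]
      ring
    · have h2 : x ^ 2 < 1 := pow_lt_one₀ hx.1.le hx.2 two_ne_zero
      have h3 : 1 - x ^ 2 ≠ 0 := by linarith
      have h4 : (1 - x ^ 4) = (1 - x ^ 2) * (1 + x ^ 2) := by ring
      have := one_add_sq_ne_zero x
      rw [h4]
      field_simp

/-! ### Moments of `arctan x` and `arctan² x` -/

theorem continuous_pow_mul_arctan_div (a : ℕ) :
    Continuous fun x : ℝ => x ^ a * Real.arctan x / (1 + x ^ 2) :=
  Continuous.div (by fun_prop) (by fun_prop) one_add_sq_ne_zero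

/-- `∫₀¹ xᵃ log x arctan x / (1+x²)`. -/
noncomputable def logArctanMoment (a : ℕ) : ℝ :=
  ∫ x in (0 : ℝ)..1, x ^ a * Real.arctan x / (1 + x ^ 2) * Real.log x

/-- `∫₀¹ xᵃ arctan x / (1+x²)`. -/
noncomputable def arctanMoment (a : ℕ) : ℝ :=
  ∫ x in (0 : ℝ)..1, x ^ a * Real.arctan x / (1 + x ^ 2)

theorem hasDerivAt_pow_div (m : ℕ) (x : ℝ) :
    HasDerivAt (fun x : ℝ => x ^ (m + 1) / ((m : ℝ) + 1)) (x ^ m) x := by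
  have hm : (m : ℝ) + 1 ≠ 0 := by positivity
  refine ((hasDerivAt_pow (m + 1) x).div_const ((m : ℝ) + 1)).congr_deriv ?_
  simp
  field_simp

theorem integral_pow_mul_arctan (m : ℕ) :
    ∫ x in (0 : ℝ)..1, x ^ m * Real.arctan x
      = (Real.pi + polygamma 0 (((m : ℝ) + 2) / 4) - polygamma 0 (((m : ℝ) + 4) / 4))
        / (4 * ((m : ℝ) + 1)) := by
  have hm : (m : ℝ) + 1 ≠ 0 := by positivity
  have h := integral_mul_deriv_eq_deriv_mul (a := 0) (b := 1)
    (fun x _ => Real.hasDerivAt_arctan x) (fun x _ => hasDerivAt_pow_div m x)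
    (Continuous.intervalIntegrable (by
      exact Continuous.div (by fun_prop) (by fun_prop) one_add_sq_ne_zero) _ _)
    (Continuous.intervalIntegrable (by fun_prop) _ _)
  have e1 : ∫ x in (0 : ℝ)..1, 1 / (1 + x ^ 2) * (x ^ (m + 1) / ((m : ℝ) + 1))
      = (∫ x in (0 : ℝ)..1, x ^ (m + 1) / (1 + x ^ 2)) / ((m : ℝ) + 1) := by
    rw [← intervalIntegral.integral_div]
    refine integral_congr fun x _ => ?_
    ring
  simp only [mul_comm (Real.arctan _) (_ ^ m)] at h
  rw [h, e1, integral_pow_div]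
  simp only [Real.arctan_one, Real.arctan_zero, one_pow]
  push_cast
  rw [show (m : ℝ) + 1 + 3 = m + 4 by ring, show (m : ℝ) + 1 + 1 = m + 2 by ring]
  field_simp
  ring

theorem integral_pow_mul_log_mul_arctan (m : ℕ) :
    ∫ x in (0 : ℝ)..1, x ^ m * Real.arctan x * Real.log x
      = 1 / (16 * ((m : ℝ) + 1) ^ 2) *
        (-(4 * Real.pi) + 4 * polygamma 0 (((m : ℝ) + 4) / 4) - 4 * polygamma 0 (((m : ℝ) + 2) / 4)
          - ((m : ℝ) + 1) *
            (polygamma 1 (((m : ℝ) + 4) / 4) - polygamma 1 (((m : ℝ) + 2) / 4))) := by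
  have hm : (m : ℝ) + 1 ≠ 0 := by positivity
  have i1 : IntervalIntegrable (fun x : ℝ => x ^ m * Real.arctan x * Real.log x) volume 0 1 :=
    intervalIntegrable_mul_log (by fun_prop)
  have i2 : IntervalIntegrable (fun x : ℝ => x ^ (m + 1) * Real.log x / (1 + x ^ 2)) volume 0 1 :=
    Continuous.intervalIntegrable (Continuous.div (continuous_pow_succ_mul_log m)
      (by fun_prop) one_add_sq_ne_zero) _ _
  have i3 : IntervalIntegrable (fun x : ℝ => x ^ (m + 1) / (1 + x ^ 2)) volume 0 1 :=
    Continuous.intervalIntegrable (Continuous.div (by fun_prop)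
      (by fun_prop) one_add_sq_ne_zero) _ _
  have h := integral_eq_sub_of_hasDerivAt_of_le zero_le_one
    -- Parts with the primitive of `x^m log x`, which extends continuously to `0` and vanishes
    -- there; only the endpoint `1` contributes to the boundary term.
    (f := fun x => (x ^ (m + 1) * Real.log x / (m + 1) - x ^ (m + 1) / ((m : ℝ) + 1) ^ 2)
      * Real.arctan x)
    (f' := fun x => x ^ m * Real.arctan x * Real.log x
      + (x ^ (m + 1) * Real.log x / (1 + x ^ 2) / (m + 1)
        - x ^ (m + 1) / (1 + x ^ 2) / ((m : ℝ) + 1) ^ 2))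
    ((continuous_logPrimitive m).mul Real.continuous_arctan).continuousOn
    (fun x hx => ((hasDerivAt_logPrimitive m hx.1.ne').fun_mul
      (Real.hasDerivAt_arctan x)).congr_deriv (by ring))
    (i1.add ((i2.div_const _).sub (i3.div_const _)))
  rw [intervalIntegral.integral_add i1 ((i2.div_const _).sub (i3.div_const _)),
    intervalIntegral.integral_sub (i2.div_const _) (i3.div_const _),
    intervalIntegral.integral_div, intervalIntegral.integral_div, integral_pow_div,
    integral_pow_mul_log_div] at h
  rw [← eq_sub_iff_add_eq] at h
  rw [h]
  simp only [Real.arctan_one, Real.arctan_zero, one_pow, Real.log_one]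
  push_cast
  rw [show (m : ℝ) + 1 + 3 = m + 4 by ring, show (m : ℝ) + 1 + 1 = m + 2 by ring]
  field_simp
  ring

theorem arctanMoment_add_two (a : ℕ) :
    arctanMoment (a + 2) = (∫ x in (0 : ℝ)..1, x ^ a * Real.arctan x) - arctanMoment a := by
  rw [eq_sub_iff_add_eq, arctanMoment, arctanMoment, ← intervalIntegral.integral_add
    ((continuous_pow_mul_arctan_div _).intervalIntegrable _ _)
    ((continuous_pow_mul_arctan_div _).intervalIntegrable _ _)]
  refine integral_congr fun x _ => ?_
  have := one_add_sq_ne_zero x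
  field_simp
  ring

theorem logArctanMoment_add_two (a : ℕ) :
    logArctanMoment (a + 2)
      = (∫ x in (0 : ℝ)..1, x ^ a * Real.arctan x * Real.log x) - logArctanMoment a := by
  rw [eq_sub_iff_add_eq, logArctanMoment, logArctanMoment, ← intervalIntegral.integral_add
    (intervalIntegrable_mul_log (continuous_pow_mul_arctan_div _))
    (intervalIntegrable_mul_log (continuous_pow_mul_arctan_div _))]
  refine integral_congr fun x _ => ?_
  have := one_add_sq_ne_zero x
  field_simp
  ring

/-- The index `j` counts steps down from the top, so an induction step inserts a new `j = 1` term
and shifts the others with a sign. Truncated subtraction is harmless because `j ≤ k`. -/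
theorem eq_sum_of_add_two_eq_sub {u v : ℕ → ℝ} (h : ∀ a, u (a + 2) = v a - u a) (s k : ℕ) :
    u (2 * k + s)
      = (∑ j ∈ Finset.Icc 1 k, (-1) ^ (j + 1) * v (2 * k + s - 2 * j)) + (-1) ^ k * u s := by
  induction k with
  | zero => simp
  | succ k ih =>
    rw [show 2 * (k + 1) + s = 2 * k + s + 2 by ring, h, ih,
      ← Finset.add_sum_Ioc_eq_sum_Icc (by omega : 1 ≤ k + 1)]
    have : ∑ j ∈ Finset.Ioc 1 (k + 1), (-1 : ℝ) ^ (j + 1) * v (2 * k + s + 2 - 2 * j)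
        = ∑ j ∈ Finset.Icc 1 k, -((-1) ^ (j + 1) * v (2 * k + s - 2 * j)) := by
      refine (Finset.sum_nbij (fun j => j + 1) ?_ ?_ ?_ ?_).symm
      · intro j hj
        simp only [Finset.mem_Icc, Finset.mem_Ioc] at hj ⊢
        omega
      · intro i _ j _ hij
        simpa using hij
      · intro j hj
        simp only [Finset.coe_Icc, Finset.coe_Ioc, mem_Ioc, mem_image, mem_Icc] at hj ⊢
        exact ⟨j - 1, by omega, by omega⟩
      · intro j hj
        rw [show 2 * k + s + 2 - 2 * (j + 1) = 2 * k + s - 2 * j by omega]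
        ring
    rw [this, Finset.sum_neg_distrib, show 2 * k + s + 2 - 2 * 1 = 2 * k + s by omega]
    ring

theorem integral_pow_mul_log_mul_arctan_sq (m : ℕ) :
    ∫ x in (0 : ℝ)..1, x ^ m * Real.arctan x ^ 2 * Real.log x
      = 1 / ((m : ℝ) + 1) * (-(Real.pi ^ 2 / (16 * ((m : ℝ) + 1))) - 2 * logArctanMoment (m + 1)
        + 2 / ((m : ℝ) + 1) * arctanMoment (m + 1)) := by
  have hm : (m : ℝ) + 1 ≠ 0 := by positivity
  have i1 : IntervalIntegrable (fun x : ℝ => x ^ m * Real.arctan x ^ 2 * Real.log x) volume 0 1 :=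
    intervalIntegrable_mul_log (by fun_prop)
  have i2 := (intervalIntegrable_mul_log (continuous_pow_mul_arctan_div (m + 1))).const_mul
    (2 / ((m : ℝ) + 1))
  have i3 := ((continuous_pow_mul_arctan_div (m + 1)).intervalIntegrable 0 1
    (μ := volume)).const_mul (2 / ((m : ℝ) + 1) ^ 2)
  have h := integral_eq_sub_of_hasDerivAt_of_le zero_le_one
    (f := fun x => (x ^ (m + 1) * Real.log x / (m + 1) - x ^ (m + 1) / ((m : ℝ) + 1) ^ 2)
      * Real.arctan x ^ 2)
    ((continuous_logPrimitive m).mul (Real.continuous_arctan.pow 2)).continuousOn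
    (fun x hx => ((hasDerivAt_logPrimitive m hx.1.ne').fun_mul
      ((Real.hasDerivAt_arctan x).fun_pow 2)).congr_deriv (by
        push_cast
        ring))
    (i1.add (i2.sub i3))
  rw [intervalIntegral.integral_add i1 (i2.sub i3), intervalIntegral.integral_sub i2 i3,
    intervalIntegral.integral_const_mul, intervalIntegral.integral_const_mul,
    ← arctanMoment, ← logArctanMoment, ← eq_sub_iff_add_eq] at h
  rw [h]
  simp only [Real.arctan_one, Real.arctan_zero, one_pow, Real.log_one]
  field_simp
  ring

/-! ### The series in terms of moments -/

theorem oddHarmonic_eq_sum_range (n : ℕ) :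
    oddHarmonic n = ∑ i ∈ Finset.range n, 1 / (2 * (i : ℝ) + 1) := by
  induction n with
  | zero => simp [oddHarmonic]
  | succ n ih =>
    rw [Finset.sum_range_succ, ← ih, oddHarmonic, oddHarmonic,
      Finset.sum_Icc_succ_top (by omega)]
    push_cast
    ring

/-- Partial fractions: on the antidiagonal `(2i+1) + (2j+1) = 2(n+1)`, so each product of
reciprocals is their sum divided by `2(n+1)`. This gives the coefficients of the Cauchy square of
the arctangent series. -/
theorem sum_antidiagonal_one_div_odd (n : ℕ) :
    ∑ p ∈ Finset.HasAntidiagonal.antidiagonal n, (1 / (2 * (p.1 : ℝ) + 1)) * (1 / (2 * (p.2 : ℝ) + 1))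
      = oddHarmonic (n + 1) / (n + 1) := by
  have h2 : ∑ p ∈ Finset.HasAntidiagonal.antidiagonal n, 1 / (2 * (p.1 : ℝ) + 1) = oddHarmonic (n + 1) := by
    rw [oddHarmonic_eq_sum_range, Finset.Nat.sum_antidiagonal_eq_sum_range_succ_mk]
  have h3 : ∑ p ∈ Finset.HasAntidiagonal.antidiagonal n, 1 / (2 * (p.2 : ℝ) + 1) = oddHarmonic (n + 1) := by
    rw [← h2, ← Finset.Nat.sum_antidiagonal_swap]
    rfl
  have h4 : oddHarmonic (n + 1) / (n + 1)
      = (∑ p ∈ Finset.HasAntidiagonal.antidiagonal n, (1 / (2 * (p.1 : ℝ) + 1) + 1 / (2 * (p.2 : ℝ) + 1)))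
        / (2 * (n + 1)) := by
    rw [Finset.sum_add_distrib, h2, h3]
    field_simp
    ring
  rw [h4, Finset.sum_div]
  refine Finset.sum_congr rfl fun p hp => ?_
  have : (n : ℝ) = p.1 + p.2 := by
    rw [← Finset.HasAntidiagonal.mem_antidiagonal.1 hp]
    push_cast
    ring
  rw [this]
  field_simp
  ring

theorem hasSum_arctan_sq {x : ℝ} (hx : |x| < 1) :
    HasSum (fun n : ℕ => (-1) ^ n * (oddHarmonic (n + 1) / (n + 1)) * x ^ (2 * n + 2))
      (Real.arctan x ^ 2) := by
  have h := Real.hasSum_arctan (x := x) hx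
  have hs : Summable fun n : ℕ => ‖(-1) ^ n * x ^ (2 * n + 1) / ((2 * n + 1 : ℕ) : ℝ)‖ :=
    h.summable.norm
  have h1 := tsum_mul_tsum_eq_tsum_sum_antidiagonal_of_summable_norm hs hs
  have h2 := (summable_norm_sum_mul_antidiagonal_of_summable_norm hs hs).of_norm.hasSum
  rw [← h1, h.tsum_eq] at h2
  refine h2.of_eq (fun n => ?_) (sq _)
  rw [← sum_antidiagonal_one_div_odd, Finset.mul_sum, Finset.sum_mul]
  refine Finset.sum_congr rfl fun p hp => ?_
  rw [← Finset.HasAntidiagonal.mem_antidiagonal.1 hp]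
  push_cast
  ring

theorem oddHarmonic_nonneg (n : ℕ) : 0 ≤ oddHarmonic n := by
  refine Finset.sum_nonneg fun i hi => ?_
  have : (1 : ℝ) ≤ i := by exact_mod_cast (Finset.mem_Icc.1 hi).1
  exact one_div_nonneg.2 (by linarith)

theorem oddHarmonic_le (n : ℕ) : oddHarmonic n ≤ n := by
  have : oddHarmonic n ≤ ∑ i ∈ Finset.Icc 1 n, (1 : ℝ) := by
    refine Finset.sum_le_sum fun i hi => ?_
    have : (1 : ℝ) ≤ i := by exact_mod_cast (Finset.mem_Icc.1 hi).1
    rw [div_le_one (by linarith)]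
    linarith
  simpa using this

theorem hasSum_oddHarmonic_moment (m : ℕ) :
    HasSum (fun n : ℕ => (-1 : ℝ) ^ (n + 1) * oddHarmonic (n + 1) /
        (((n : ℝ) + 1) * (2 * ((n : ℝ) + 1) + m + 1) ^ 2))
      (∫ x in (0 : ℝ)..1, x ^ m * Real.arctan x ^ 2 * Real.log x) := by
  have h := hasSum_integral_pow_mul_log
    (c := fun n => (-1) ^ n * (oddHarmonic (n + 1) / (n + 1))) (e := fun n => 2 * n + 2 + m)
    (f := fun x => x ^ m * Real.arctan x ^ 2 * Real.log x) ?_ ?_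
  · refine h.of_eq (fun n => ?_) rfl
    push_cast
    rw [pow_succ]
    field_simp
  · refine (summable_one_div_nat_add_sq (c := 1) one_pos).of_nonneg_of_le
      (fun n => by positivity) fun n => ?_
    have h1 := oddHarmonic_nonneg (n + 1)
    -- The crude bound `h_n ≤ n` suffices: the coefficients are then at most `1` in absolute value,
    -- and the squared denominator ensures convergence.
    have h2 := oddHarmonic_le (n + 1)
    push_cast at h2
    rw [abs_mul, abs_pow, abs_neg, abs_one, one_pow, one_mul, abs_of_nonneg (by positivity)]
    have : (0 : ℝ) ≤ n := n.cast_nonneg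
    have : (0 : ℝ) ≤ m := m.cast_nonneg
    push_cast
    gcongr
    · rw [div_le_one (by positivity)]
      exact h2
    · linarith
  · intro x hx
    have h1 := hasSum_arctan_sq (x := x) (by rw [abs_of_pos hx.1]; exact hx.2)
    refine (h1.mul_left (x ^ m * Real.log x)).of_eq (fun n => ?_) ?_
    · rw [pow_add x (2 * n + 2) m]
      ring
    · ring

/-! ### Polylogarithms on the unit disc -/

theorem summable_one_div_succ_pow {s : ℕ} (hs : 2 ≤ s) :
    Summable fun k : ℕ => 1 / ((k : ℝ) + 1) ^ s := by
  have h := (summable_nat_add_iff 1).2 (Real.summable_one_div_nat_pow.2 hs)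
  simpa using h

theorem norm_polylog_term_le (s : ℕ) {z : ℂ} (hz : ‖z‖ ≤ 1) (k : ℕ) :
    ‖z ^ (k + 1) / ((k : ℂ) + 1) ^ s‖ ≤ 1 / ((k : ℝ) + 1) ^ s := by
  have : ‖(k : ℂ) + 1‖ = (k : ℝ) + 1 := by
    rw [← Nat.cast_succ, Complex.norm_natCast, Nat.cast_succ]
  rw [norm_div, norm_pow, norm_pow, this]
  gcongr
  exact pow_le_one₀ (norm_nonneg _) hz

theorem hasSum_polylog {s : ℕ} (hs : 2 ≤ s) {z : ℂ} (hz : ‖z‖ ≤ 1) :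
    HasSum (fun k : ℕ => z ^ (k + 1) / ((k : ℂ) + 1) ^ s) (polylog s z) :=
  (Summable.of_norm_bounded (summable_one_div_succ_pow hs) (norm_polylog_term_le s hz)).hasSum

theorem continuousOn_polylog {s : ℕ} (hs : 2 ≤ s) :
    ContinuousOn (polylog s) (Metric.closedBall 0 1) :=
  continuousOn_tsum (fun k => by fun_prop) (summable_one_div_succ_pow hs)
    fun k z hz => norm_polylog_term_le s (by simpa using hz) k

theorem polylog_zero_right (s : ℕ) : polylog s 0 = 0 := by simp [polylog]

theorem polylog_one_left {z : ℂ} (hz : ‖z‖ < 1) : polylog 1 z = -Complex.log (1 - z) := by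
  have h := (hasSum_nat_add_iff' 1).2 (Complex.hasSum_taylorSeries_neg_log hz)
  have h2 := h.tsum_eq
  simpa [polylog] using h2

theorem polylog_conj (s : ℕ) (z : ℂ) :
    polylog s (starRingEnd ℂ z) = starRingEnd ℂ (polylog s z) := by
  simp [polylog, Complex.conj_tsum]

/-- Termwise differentiation on a ball of radius `r` with `‖z‖ < r < 1`, where `r^k` dominates the
derivatives. -/
theorem hasDerivAt_polylog (s : ℕ) {z : ℂ} (hz : ‖z‖ < 1) (h0 : z ≠ 0) :
    HasDerivAt (polylog (s + 1)) (polylog s z / z) z := by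
  obtain ⟨r, hr1, hr2⟩ := exists_between hz
  have hr0 : 0 ≤ r := (norm_nonneg z).trans hr1.le
  have hd : HasDerivAt (polylog (s + 1)) (∑' k : ℕ, z ^ k / ((k : ℂ) + 1) ^ s) z := by
    refine hasDerivAt_tsum_of_isPreconnected (t := Metric.ball 0 r) (u := fun k => r ^ k)
      (g := fun (k : ℕ) z => z ^ (k + 1) / ((k : ℂ) + 1) ^ (s + 1))
      (g' := fun k z => z ^ k / ((k : ℂ) + 1) ^ s)
      (summable_geometric_of_lt_one hr0 hr2) Metric.isOpen_ball
      (convex_ball (0 : ℂ) r).isPreconnected ?_ ?_ (y₀ := 0)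
      (by simpa using (norm_nonneg z).trans_lt hr1) (by simp [summable_zero]) (by simpa using hr1)
    · intro k y _
      refine ((hasDerivAt_pow (k + 1) y).div_const (((k : ℂ) + 1) ^ (s + 1))).congr_deriv ?_
      have : (k : ℂ) + 1 ≠ 0 := Nat.cast_add_one_ne_zero k
      simp
      field_simp
      ring
    · intro k y hy
      have hy : ‖y‖ ≤ r := by simpa using (Metric.mem_ball.1 hy).le
      have : ‖(k : ℂ) + 1‖ = (k : ℝ) + 1 := by
        rw [← Nat.cast_succ, Complex.norm_natCast, Nat.cast_succ]
      rw [norm_div, norm_pow, norm_pow, this]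
      refine (div_le_self (by positivity) (one_le_pow₀ ?_)).trans
        (pow_le_pow_left₀ (norm_nonneg _) hy k)
      simp
  convert hd using 1
  rw [div_eq_iff h0, polylog, ← tsum_mul_right]
  refine tsum_congr fun k => ?_
  rw [pow_succ]
  ring

/-- The odd part `χ_s(z) = ∑ z^(2n+1)/(2n+1)^s` of the polylogarithm. -/
noncomputable def legendreChi (s : ℕ) (z : ℂ) : ℂ := (polylog s z - polylog s (-z)) / 2

theorem hasSum_legendreChi {s : ℕ} (hs : 2 ≤ s) {z : ℂ} (hz : ‖z‖ ≤ 1) :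
    HasSum (fun n : ℕ => z ^ (2 * n + 1) / (2 * (n : ℂ) + 1) ^ s) (legendreChi s z) := by
  have h := ((hasSum_polylog hs hz).sub (hasSum_polylog hs (z := -z) (by simpa using hz))).div_const
    2
  rw [← legendreChi] at h
  have hi : Function.Injective fun n : ℕ => 2 * n := fun a b hab => by simpa using hab
  rw [← hi.hasSum_iff] at h
  · refine h.of_eq (fun n => ?_) rfl
    simp only [Function.comp, neg_pow z, pow_succ, pow_mul]
    push_cast
    ring
  · intro k hk
    have : Odd k := by
      rw [← Nat.not_even_iff_odd]
      rintro ⟨m, hm⟩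
      exact hk ⟨m, by simp; omega⟩
    rw [neg_pow z, (this.add_one).neg_one_pow]
    ring

theorem hasDerivAt_legendreChi (s : ℕ) {z : ℂ} (hz : ‖z‖ < 1) (h0 : z ≠ 0) :
    HasDerivAt (legendreChi (s + 1)) (legendreChi s z / z) z := by
  have h1 := hasDerivAt_polylog s hz h0
  have h2 := (hasDerivAt_polylog s (z := -z) (by simpa using hz) (neg_ne_zero.2 h0)).comp z
    (hasDerivAt_neg z)
  refine ((h1.sub h2).div_const 2).congr_deriv ?_
  rw [legendreChi]
  field_simp

theorem continuousOn_legendreChi {s : ℕ} (hs : 2 ≤ s) :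
    ContinuousOn (legendreChi s) (Metric.closedBall 0 1) := by
  refine ((continuousOn_polylog hs).sub
    ((continuousOn_polylog hs).comp continuousOn_neg fun z hz => ?_)).div_const 2
  simpa using hz

/-! ### Special values -/

theorem legendreChi_two_I : legendreChi 2 Complex.I = Complex.I * catalanG := by
  have h := (hasSum_legendreChi le_rfl (z := Complex.I) (by simp)).tsum_eq
  rw [← h, catalanG, Complex.ofReal_tsum, ← tsum_mul_left]
  refine tsum_congr fun n => ?_
  rw [pow_succ, pow_mul, Complex.I_sq]
  push_cast
  ring

theorem legendreChi_three_I_re : (legendreChi 3 Complex.I).re = 0 := by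
  have h := Complex.hasSum_re (hasSum_legendreChi (s := 3) (by norm_num) (z := Complex.I) (by simp))
  refine h.unique (hasSum_zero.of_eq (fun n => ?_) rfl)
  have : Complex.I ^ (2 * n + 1) / (2 * (n : ℂ) + 1) ^ 3
      = (((-1) ^ n / (2 * (n : ℝ) + 1) ^ 3 : ℝ) : ℂ) * Complex.I := by
    rw [pow_succ, pow_mul, Complex.I_sq]
    push_cast
    ring
  rw [this, Complex.re_ofReal_mul, Complex.I_re, mul_zero]

/-- In `ζ(3)` the even denominators contribute `ζ(3)/8`, and the odd ones are `χ₃(1)`. -/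
theorem legendreChi_three_one_re : (legendreChi 3 1).re = 7 / 8 * zeta3 := by
  have hz : polylog 3 1 = riemannZeta 3 := by
    have h := zeta_eq_tsum_one_div_nat_add_one_cpow (s := 3) (by norm_num)
    rw [h, polylog]
    refine tsum_congr fun n => ?_
    rw [one_pow, ← Complex.cpow_natCast]
    norm_num
  have h1 := hasSum_polylog (s := 3) (by norm_num) (z := 1) (by simp)
  have h2 := (hasSum_legendreChi (s := 3) (by norm_num) (z := 1) (by simp))
  have h3 := HasSum.even_add_odd (f := fun k : ℕ => (1 : ℂ) ^ (k + 1) / ((k : ℂ) + 1) ^ 3)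
    (h2.of_eq (fun n => by simp) rfl) ((h1.div_const 8).of_eq (fun n => by
      push_cast
      rw [one_pow, one_pow, show 2 * (n : ℂ) + 1 + 1 = 2 * ((n : ℂ) + 1) by ring, mul_pow,
        div_div, mul_comm]
      norm_num) rfl)
  have h4 := h1.unique h3
  have h5 : legendreChi 3 1 = ((7 / 8 : ℝ) : ℂ) * riemannZeta 3 := by
    rw [← hz]
    push_cast
    linear_combination -h4
  rw [h5, Complex.re_ofReal_mul, zeta3]

theorem neg_I_pow (n : ℕ) :
    (-Complex.I) ^ n = ((Real.cos (Real.pi * n / 2) : ℝ) : ℂ)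
      - ((Real.sin (Real.pi * n / 2) : ℝ) : ℂ) * Complex.I := by
  have h : -Complex.I = Complex.exp (-(Real.pi / 2 * Complex.I)) := by
    rw [Complex.exp_neg, Complex.exp_pi_div_two_mul_I, Complex.inv_I]
  rw [h, ← Complex.exp_nat_mul]
  have : (n : ℂ) * -(Real.pi / 2 * Complex.I) = ((-(Real.pi * n / 2) : ℝ) : ℂ) * Complex.I := by
    push_cast
    ring
  rw [this, Complex.exp_mul_I, ← Complex.ofReal_cos, ← Complex.ofReal_sin, Real.cos_neg,
    Real.sin_neg]
  push_cast
  ring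

theorem neg_I_pow_div (s n : ℕ) :
    (-Complex.I) ^ (n + 1) / ((n : ℂ) + 1) ^ s
      = ((1 / ((n + 1 : ℕ) : ℝ) ^ s * Real.cos (Real.pi * (n + 1 : ℕ) / 2) : ℝ) : ℂ)
        - ((1 / ((n + 1 : ℕ) : ℝ) ^ s * Real.sin (Real.pi * (n + 1 : ℕ) / 2) : ℝ) : ℂ)
          * Complex.I := by
  rw [neg_I_pow]
  push_cast
  ring

/-- Up to sign this is the L-series of the character mod `4` at `3`. -/
theorem polylog_three_neg_I_im : (polylog 3 (-Complex.I)).im = -(Real.pi ^ 3 / 32) := by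
  have h := Complex.hasSum_im (hasSum_polylog (s := 3) (by norm_num) (z := -Complex.I) (by simp))
  have h2 := ((hasSum_nat_add_iff' 1).2 hasSum_L_function_mod_four_eval_three).neg
  refine h.unique (h2.of_eq (fun n => ?_) (by simp))
  rw [neg_I_pow_div]
  rw [Complex.sub_im, Complex.ofReal_im, Complex.im_ofReal_mul, Complex.I_im, mul_one, zero_sub]

theorem polylog_two_neg_I_re : (polylog 2 (-Complex.I)).re = -(Real.pi ^ 2 / 48) := by
  have h := Complex.hasSum_re (hasSum_polylog (s := 2) le_rfl (z := -Complex.I) (by simp))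
  -- The Fourier series of the second Bernoulli polynomial at `1/4`, with `B₂(1/4) = -1/48`.
  have h1 := hasSum_one_div_nat_pow_mul_cos one_ne_zero (x := 1 / 4) (by norm_num)
  have h2 := ((hasSum_nat_add_iff' 1).2 h1)
  refine h.unique (h2.of_eq (fun n => ?_) ?_)
  · rw [neg_I_pow_div]
    rw [Complex.sub_re, Complex.ofReal_re, Complex.re_ofReal_mul, Complex.I_re, mul_zero, sub_zero]
    congr 2
    ring
  · have h3 : (1 / 4 : ℝ) = algebraMap ℚ ℝ (1 / 4) := by simp
    have h4 : (Polynomial.bernoulli 2).eval (1 / 4) = -1 / 48 := by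
      simp_rw [Polynomial.bernoulli, Finset.sum_range_succ, Polynomial.eval_add,
        Polynomial.eval_monomial]
      rw [bernoulli_one, bernoulli_two]
      norm_num
    rw [h3, mul_one, Polynomial.eval_map, Polynomial.eval₂_at_apply, h4]
    simp
    ring

theorem polylog_two_neg_I_im : (polylog 2 (-Complex.I)).im = -catalanG := by
  have h1 := congrArg Complex.im legendreChi_two_I
  have h2 := polylog_conj 2 (-Complex.I)
  simp only [map_neg, Complex.conj_I, neg_neg] at h2
  rw [legendreChi, h2] at h1
  simp at h1
  linarith

/-! ### The Cayley parametrization of the quarter circle -/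

theorem ofReal_add_ofReal_mul_I_re (a b : ℝ) : ((a : ℂ) + (b : ℂ) * Complex.I).re = a := by
  rw [Complex.add_re, Complex.re_ofReal_mul, Complex.ofReal_re, Complex.I_re, mul_zero, add_zero]

theorem ofReal_add_ofReal_mul_I_im (a b : ℝ) : ((a : ℂ) + (b : ℂ) * Complex.I).im = b := by
  rw [Complex.add_im, Complex.im_ofReal_mul, Complex.ofReal_im, Complex.I_im, mul_one, zero_add]

theorem log_one_add_mul_I (x : ℝ) :
    Complex.log (1 + x * Complex.I)
      = ((Real.log (1 + x ^ 2) / 2 : ℝ) : ℂ) + (Real.arctan x : ℝ) * Complex.I := by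
  have h1 : ‖1 + x * Complex.I‖ = Real.sqrt (1 + x ^ 2) := by
    simpa using Complex.norm_add_mul_I 1 x
  have h2 : Complex.arg (1 + x * Complex.I) = Real.arctan x := by
    rw [Complex.arg_of_re_nonneg (by simp), h1, Real.arctan_eq_arcsin]
    simp
  apply Complex.ext
  · rw [Complex.log_re, h1, Real.log_sqrt (by positivity), ofReal_add_ofReal_mul_I_re]
  · rw [Complex.log_im, h2, ofReal_add_ofReal_mul_I_im]

theorem one_add_mul_I_ne_zero (x : ℝ) : 1 + x * Complex.I ≠ 0 := by
  intro h
  simpa using congrArg Complex.re h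

theorem one_sub_mul_I_ne_zero (x : ℝ) : 1 - x * Complex.I ≠ 0 := by
  intro h
  simpa using congrArg Complex.re h

theorem log_one_sub_mul_I (x : ℝ) :
    Complex.log (1 - x * Complex.I)
      = ((Real.log (1 + x ^ 2) / 2 : ℝ) : ℂ) - (Real.arctan x : ℝ) * Complex.I := by
  have h := log_one_add_mul_I (-x)
  rw [Real.arctan_neg] at h
  push_cast at h ⊢
  rw [neg_mul, ← sub_eq_add_neg] at h
  rw [h, neg_sq]
  ring

/-- The Cayley transform `x ↦ (1+ix)/(1-ix)`, mapping `[0,1]` onto the arc from `1` to `i`. -/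
noncomputable def cayley (x : ℝ) : ℂ := (1 + x * Complex.I) / (1 - x * Complex.I)

theorem cayley_zero : cayley 0 = 1 := by simp [cayley]

theorem cayley_one : cayley 1 = Complex.I := by
  rw [cayley, div_eq_iff (one_sub_mul_I_ne_zero 1)]
  simp only [Complex.ofReal_one, one_mul, mul_sub, mul_one, Complex.I_mul_I]
  ring

theorem norm_cayley (x : ℝ) : ‖cayley x‖ = 1 := by
  have h : (1 - x * Complex.I : ℂ) = starRingEnd ℂ (1 + x * Complex.I) := by
    simp [sub_eq_add_neg]
  rw [cayley, norm_div, h, RCLike.norm_conj, div_self]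
  exact norm_ne_zero_iff.2 (one_add_mul_I_ne_zero x)

theorem cayley_ne_zero (x : ℝ) : cayley x ≠ 0 :=
  div_ne_zero (one_add_mul_I_ne_zero x) (one_sub_mul_I_ne_zero x)

theorem one_add_sq_eq (x : ℝ) :
    (1 + (x : ℂ) ^ 2) = (1 + x * Complex.I) * (1 - x * Complex.I) := by
  linear_combination (x : ℂ) ^ 2 * Complex.I_sq

theorem hasDerivAt_cayley (x : ℝ) :
    HasDerivAt cayley (cayley x * (2 * Complex.I / (1 + (x : ℂ) ^ 2))) x := by
  have h0 : HasDerivAt (fun x : ℝ => (x : ℂ) * Complex.I) Complex.I x := by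
    simpa using (Complex.ofRealCLM.hasDerivAt (x := x)).mul_const Complex.I
  refine ((h0.const_add 1).fun_div (h0.const_sub 1) (one_sub_mul_I_ne_zero x)).congr_deriv ?_
  have h1 := one_sub_mul_I_ne_zero x
  have h2 := one_add_mul_I_ne_zero x
  rw [cayley, one_add_sq_eq, div_mul_div_comm, div_eq_div_iff (pow_ne_zero 2 h1)
    (mul_ne_zero h1 (mul_ne_zero h2 h1))]
  ring

theorem continuous_cayley : Continuous cayley :=
  continuous_iff_continuousAt.2 fun x => (hasDerivAt_cayley x).continuousAt

/-- With `w = c * cayley x` one has `dw/w = 2i dx/(1+x²)`, hence the form `h/w` for the derivative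
of `F`. The factor `i` makes imaginary parts of `F` integrate real parts of `h`, and vice versa up
to sign. -/
theorem hasDerivAt_comp_cayley {F : ℂ → ℂ} {c h : ℂ} {x : ℝ} (hc : c ≠ 0)
    (hF : HasDerivAt F (h / (c * cayley x)) (c * cayley x)) :
    HasDerivAt (fun x : ℝ => F (c * cayley x)) (h * (2 * Complex.I / (1 + (x : ℂ) ^ 2))) x := by
  have h1 := hF.comp x ((hasDerivAt_cayley x).const_mul c)
  refine h1.congr_deriv ?_
  have := cayley_ne_zero x
  field_simp

theorem hasDerivAt_im_comp_cayley {F : ℂ → ℂ} {c h : ℂ} {x : ℝ} (hc : c ≠ 0)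
    (hF : HasDerivAt F (h / (c * cayley x)) (c * cayley x)) :
    HasDerivAt (fun x : ℝ => (F (c * cayley x)).im) (2 * h.re / (1 + x ^ 2)) x := by
  have h1 := Complex.imCLM.hasFDerivAt.comp_hasDerivAt x (hasDerivAt_comp_cayley hc hF)
  refine h1.congr_deriv ?_
  have : h * (2 * Complex.I / (1 + (x : ℂ) ^ 2))
      = ((2 / (1 + x ^ 2) : ℝ) : ℂ) * (h * Complex.I) := by
    push_cast
    ring
  rw [Complex.imCLM_apply, this, Complex.im_ofReal_mul, Complex.mul_I_im]
  ring

theorem hasDerivAt_re_comp_cayley {F : ℂ → ℂ} {c h : ℂ} {x : ℝ} (hc : c ≠ 0)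
    (hF : HasDerivAt F (h / (c * cayley x)) (c * cayley x)) :
    HasDerivAt (fun x : ℝ => (F (c * cayley x)).re) (-(2 * h.im / (1 + x ^ 2))) x := by
  have h1 := Complex.reCLM.hasFDerivAt.comp_hasDerivAt x (hasDerivAt_comp_cayley hc hF)
  refine h1.congr_deriv ?_
  have : h * (2 * Complex.I / (1 + (x : ℂ) ^ 2))
      = ((2 / (1 + x ^ 2) : ℝ) : ℂ) * (h * Complex.I) := by
    push_cast
    ring
  rw [Complex.reCLM_apply, this, Complex.re_ofReal_mul, Complex.mul_I_re]
  ring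

theorem norm_mul_cayley {r : ℝ} (hr : 0 ≤ r) (x : ℝ) : ‖(r : ℂ) * cayley x‖ = r := by
  rw [norm_mul, norm_cayley, mul_one, Complex.norm_real, Real.norm_of_nonneg hr]

theorem exp_half_log_add_arctan (x : ℝ) :
    Complex.exp (-((Real.log (1 + x ^ 2) / 2 : ℝ) : ℂ) + (Real.arctan x : ℝ) * Complex.I)
      = (1 - x * Complex.I)⁻¹ := by
  have h := congrArg Complex.exp (log_one_sub_mul_I x)
  rw [Complex.exp_log (one_sub_mul_I_ne_zero x)] at h
  rw [h, ← Complex.exp_neg]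
  congr 1
  ring

/-- Here `1 + z = 2/(1-ix)`; the branch is the principal one because `arctan x` lies in `(-π/2,
π/2)`. -/
theorem log_one_add_cayley (x : ℝ) :
    Complex.log (1 + cayley x)
      = ((Real.log 2 - Real.log (1 + x ^ 2) / 2 : ℝ) : ℂ) + (Real.arctan x : ℝ) * Complex.I := by
  have h1 : 1 + cayley x
      = Complex.exp (((Real.log 2 - Real.log (1 + x ^ 2) / 2 : ℝ) : ℂ)
        + (Real.arctan x : ℝ) * Complex.I) := by
    have := one_sub_mul_I_ne_zero x
    rw [Complex.ofReal_sub, sub_add, sub_eq_add_neg, Complex.exp_add, ← Complex.ofReal_exp,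
      Real.exp_log two_pos, neg_sub, sub_eq_neg_add, exp_half_log_add_arctan, cayley]
    field_simp
    push_cast
    ring
  have h2 := Real.neg_pi_div_two_lt_arctan x
  have h3 := Real.arctan_lt_pi_div_two x
  have h4 := Real.pi_pos
  rw [h1, Complex.log_exp] <;> rw [ofReal_add_ofReal_mul_I_im] <;> linarith

/-- Here `1 - z = -2ix/(1-ix)`, where `-i` contributes `-π/2` to the argument. -/
theorem log_one_sub_cayley {x : ℝ} (hx : 0 < x) :
    Complex.log (1 - cayley x)
      = ((Real.log 2 + Real.log x - Real.log (1 + x ^ 2) / 2 : ℝ) : ℂ)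
        + (Real.arctan x - Real.pi / 2 : ℝ) * Complex.I := by
  have h1 : 1 - cayley x
      = Complex.exp (((Real.log 2 + Real.log x - Real.log (1 + x ^ 2) / 2 : ℝ) : ℂ)
        + (Real.arctan x - Real.pi / 2 : ℝ) * Complex.I) := by
    have := one_sub_mul_I_ne_zero x
    have e : ((Real.log 2 + Real.log x - Real.log (1 + x ^ 2) / 2 : ℝ) : ℂ)
        + (Real.arctan x - Real.pi / 2 : ℝ) * Complex.I
        = (Real.log 2 : ℝ) + ((Real.log x : ℝ) + (-(Real.pi / 2 * Complex.I)
          + (-((Real.log (1 + x ^ 2) / 2 : ℝ) : ℂ) + (Real.arctan x : ℝ) * Complex.I))) := by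
      push_cast
      ring
    rw [e, Complex.exp_add, Complex.exp_add, Complex.exp_add, exp_half_log_add_arctan,
      Complex.exp_neg, Complex.exp_pi_div_two_mul_I, Complex.inv_I, ← Complex.ofReal_exp,
      ← Complex.ofReal_exp, Real.exp_log two_pos, Real.exp_log hx, cayley]
    field_simp
    push_cast
    ring
  have h2 := Real.neg_pi_div_two_lt_arctan x
  have h3 := Real.arctan_lt_pi_div_two x
  have h4 := Real.pi_pos
  rw [h1, Complex.log_exp] <;> rw [ofReal_add_ofReal_mul_I_im] <;> linarith

/-! ### Radial limits of integrals along the quarter circle -/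

theorem re_cayley (x : ℝ) : (cayley x).re = (1 - x ^ 2) / (1 + x ^ 2) := by
  have : cayley x = (((1 - x ^ 2) / (1 + x ^ 2) : ℝ) : ℂ)
      + ((2 * x / (1 + x ^ 2) : ℝ) : ℂ) * Complex.I := by
    have h1 := one_sub_mul_I_ne_zero x
    have h2 := one_add_mul_I_ne_zero x
    push_cast
    rw [one_add_sq_eq, cayley]
    field_simp
    linear_combination (x : ℂ) ^ 2 * Complex.I_sq
  rw [this, ofReal_add_ofReal_mul_I_re]

theorem one_sub_mul_cayley_mem_slitPlane {r x : ℝ} (hr : 0 ≤ r) (hr1 : r ≤ 1) (hx : 0 < x) :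
    1 - (r : ℂ) * cayley x ∈ Complex.slitPlane := by
  left
  rw [Complex.sub_re, Complex.re_ofReal_mul, re_cayley, Complex.one_re, sub_pos]
  have : (1 - x ^ 2) / (1 + x ^ 2) < 1 := by
    rw [div_lt_one (by positivity)]
    nlinarith
  rcases hr.eq_or_lt with h | h
  · simp [← h]
  · nlinarith

theorem one_le_re_one_add_mul_cayley {r x : ℝ} (hr : 0 ≤ r) (hx : x ∈ Icc (0 : ℝ) 1) :
    1 ≤ (1 + (r : ℂ) * cayley x).re := by
  rw [Complex.add_re, Complex.re_ofReal_mul, re_cayley, Complex.one_re, le_add_iff_nonneg_right]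
  have : x ^ 2 ≤ 1 := pow_le_one₀ hx.1 hx.2
  exact mul_nonneg hr (div_nonneg (by linarith) (by positivity))

theorem norm_one_add_mul_cayley_le {r : ℝ} (hr : 0 ≤ r) (hr1 : r ≤ 1) (x : ℝ) :
    ‖1 + (r : ℂ) * cayley x‖ ≤ 2 := by
  refine (norm_add_le _ _).trans ?_
  rw [norm_mul_cayley hr, norm_one]
  linarith

theorem norm_one_sub_mul_cayley_le {r : ℝ} (hr : 0 ≤ r) (hr1 : r ≤ 1) (x : ℝ) :
    ‖1 - (r : ℂ) * cayley x‖ ≤ 2 := by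
  refine (norm_sub_le _ _).trans ?_
  rw [norm_mul_cayley hr, norm_one]
  linarith

/-- A lower bound uniform in `r`, which controls the logarithmic singularity at `z = 1` as `r → 1`.
It comes from `1 - rz = ((1-r) - (1+r)xi)/(1-ix)`: the numerator has norm at least `x`, the
denominator at most `2`. -/
theorem div_two_le_norm_one_sub_mul_cayley {r x : ℝ} (hr : 0 ≤ r) (hx : x ∈ Icc (0 : ℝ) 1) :
    x / 2 ≤ ‖1 - (r : ℂ) * cayley x‖ := by
  have h1 := one_sub_mul_I_ne_zero x
  have h2 : 1 - (r : ℂ) * cayley x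
      = (((1 - r : ℝ) : ℂ) - ((1 + r) * x : ℝ) * Complex.I) / (1 - x * Complex.I) := by
    rw [cayley]
    field_simp
    push_cast
    ring
  have h3 : x ≤ ‖((1 - r : ℝ) : ℂ) - ((1 + r) * x : ℝ) * Complex.I‖ := by
    refine le_trans ?_ (Complex.abs_im_le_norm _)
    have : (((1 - r : ℝ) : ℂ) - ((1 + r) * x : ℝ) * Complex.I).im = -((1 + r) * x) := by
      rw [Complex.sub_im, Complex.im_ofReal_mul, Complex.ofReal_im, Complex.I_im]
      ring
    rw [this, abs_neg, abs_of_nonneg (mul_nonneg (by linarith) hx.1)]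
    nlinarith [mul_nonneg hr hx.1]
  have h4 : ‖(1 - x * Complex.I : ℂ)‖ ≤ 2 := by
    refine (norm_sub_le _ _).trans ?_
    rw [norm_mul, Complex.norm_I, norm_one, Complex.norm_real, Real.norm_of_nonneg hx.1]
    linarith [hx.2]
  rw [h2, norm_div]
  exact div_le_div₀ (norm_nonneg _) h3 (norm_pos_iff.2 h1) h4

theorem norm_log_le (z : ℂ) : ‖Complex.log z‖ ≤ |Real.log ‖z‖| + Real.pi := by
  refine (Complex.norm_le_abs_re_add_abs_im _).trans ?_
  rw [Complex.log_re, Complex.log_im]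
  gcongr
  exact Complex.abs_arg_le_pi z

theorem norm_log_one_add_mul_cayley_le {r x : ℝ} (hr : 0 ≤ r) (hr1 : r ≤ 1)
    (hx : x ∈ Icc (0 : ℝ) 1) : ‖Complex.log (1 + (r : ℂ) * cayley x)‖ ≤ 5 := by
  refine (norm_log_le _).trans ?_
  have h1 := (one_le_re_one_add_mul_cayley hr hx).trans (Complex.re_le_norm _)
  have h2 := Real.log_le_log (by linarith) (norm_one_add_mul_cayley_le hr hr1 x)
  rw [abs_of_nonneg (Real.log_nonneg h1)]
  linarith [Real.log_two_lt_d9, Real.pi_lt_d2]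

theorem norm_log_one_sub_mul_cayley_le {r x : ℝ} (hr : 0 ≤ r) (hr1 : r ≤ 1)
    (hx : x ∈ Ioc (0 : ℝ) 1) :
    ‖Complex.log (1 - (r : ℂ) * cayley x)‖ ≤ 5 + |Real.log x| := by
  refine (norm_log_le _).trans ?_
  have h1 := div_two_le_norm_one_sub_mul_cayley hr (Ioc_subset_Icc_self hx)
  have h0 : 0 < x / 2 := half_pos hx.1
  have h2 := Real.log_le_log h0 h1
  have h3 := Real.log_le_log (h0.trans_le h1) (norm_one_sub_mul_cayley_le hr hr1 x)
  rw [Real.log_div hx.1.ne' two_ne_zero] at h2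
  have h4 := neg_abs_le (Real.log x)
  have h5 := abs_nonneg (Real.log x)
  have h6 := Real.log_two_lt_d9
  have h7 := Real.pi_lt_d2
  have : |Real.log ‖1 - (r : ℂ) * cayley x‖| ≤ Real.log 2 + |Real.log x| :=
    abs_le.2 ⟨by linarith, by linarith⟩
  linarith

/-- Dominated convergence for `r → 1`, with the integrable majorant `C (1 + |log x|)` that the
bounds on `log(1 ± rz)` provide. -/
theorem tendsto_integral_unit {G : ℝ → ℝ → ℝ} {g : ℝ → ℝ} (C : ℝ)
    (hm : ∀ r ∈ Ioo (0 : ℝ) 1, ContinuousOn (G r) (Icc 0 1))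
    (hb : ∀ r ∈ Ioo (0 : ℝ) 1, ∀ x ∈ Ioc (0 : ℝ) 1, |G r x| ≤ C * (1 + |Real.log x|))
    (hl : ∀ x ∈ Ioc (0 : ℝ) 1, Tendsto (fun r => G r x) (𝓝[<] 1) (𝓝 (g x))) :
    Tendsto (fun r => ∫ x in (0 : ℝ)..1, G r x) (𝓝[<] 1) (𝓝 (∫ x in (0 : ℝ)..1, g x)) := by
  have hmem : ∀ᶠ r : ℝ in 𝓝[<] 1, r ∈ Ioo (0 : ℝ) 1 := Ioo_mem_nhdsLT one_pos
  refine intervalIntegral.tendsto_integral_filter_of_dominated_convergence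
    (fun x => C * (1 + |Real.log x|)) ?_ ?_ ?_ ?_
  · filter_upwards [hmem] with r hr
    rw [uIoc_of_le zero_le_one]
    exact ((hm r hr).mono Ioc_subset_Icc_self).aestronglyMeasurable measurableSet_Ioc
  · filter_upwards [hmem] with r hr
    refine Eventually.of_forall fun x hx => ?_
    rw [uIoc_of_le zero_le_one] at hx
    exact hb r hr x hx
  · exact (intervalIntegrable_const.add intervalIntegrable_log'.abs).const_mul C
  · refine Eventually.of_forall fun x hx => ?_
    rw [uIoc_of_le zero_le_one] at hx
    exact hl x hx

theorem tendsto_log_one_sub_mul_cayley {x : ℝ} (hx : 0 < x) :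
    Tendsto (fun r : ℝ => Complex.log (1 - (r : ℂ) * cayley x)) (𝓝[<] 1)
      (𝓝 (Complex.log (1 - cayley x))) := by
  have h : ContinuousAt (fun r : ℝ => Complex.log (1 - (r : ℂ) * cayley x)) 1 :=
    ContinuousAt.clog (by fun_prop) (one_sub_mul_cayley_mem_slitPlane zero_le_one le_rfl hx)
  simpa using h.tendsto.mono_left nhdsWithin_le_nhds

theorem tendsto_log_one_add_mul_cayley {x : ℝ} (hx : x ∈ Icc (0 : ℝ) 1) :
    Tendsto (fun r : ℝ => Complex.log (1 + (r : ℂ) * cayley x)) (𝓝[<] 1)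
      (𝓝 (Complex.log (1 + cayley x))) := by
  have h : ContinuousAt (fun r : ℝ => Complex.log (1 + (r : ℂ) * cayley x)) 1 :=
    ContinuousAt.clog (by fun_prop)
      (Or.inl (one_pos.trans_le (one_le_re_one_add_mul_cayley zero_le_one hx)))
  simpa using h.tendsto.mono_left nhdsWithin_le_nhds

theorem continuous_log_one_sub_mul_cayley {r : ℝ} (hr : r ∈ Ioo (0 : ℝ) 1) :
    Continuous fun x => Complex.log (1 - (r : ℂ) * cayley x) := by
  refine Continuous.clog (continuous_const.sub (continuous_const.mul continuous_cayley))
    fun x => ?_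
  rw [sub_eq_add_neg]
  refine Complex.mem_slitPlane_of_norm_lt_one ?_
  rw [norm_neg, norm_mul_cayley hr.1.le]
  exact hr.2

theorem continuous_log_one_add_mul_cayley {r : ℝ} (hr : r ∈ Ioo (0 : ℝ) 1) :
    Continuous fun x => Complex.log (1 + (r : ℂ) * cayley x) := by
  refine Continuous.clog (continuous_const.add (continuous_const.mul continuous_cayley))
    fun x => Complex.mem_slitPlane_of_norm_lt_one ?_
  rw [norm_mul_cayley hr.1.le]
  exact hr.2

/-! ### The initial moments -/

theorem arctanMoment_zero : arctanMoment 0 = Real.pi ^ 2 / 32 := by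
  rw [arctanMoment, integral_eq_sub_of_hasDerivAt (f := fun x => Real.arctan x ^ 2 / 2)
    (fun x _ => (((Real.hasDerivAt_arctan x).fun_pow 2).div_const 2).congr_deriv (by
      push_cast
      ring))
    ((continuous_pow_mul_arctan_div 0).intervalIntegrable _ _)]
  simp only [Real.arctan_one, Real.arctan_zero]
  ring

theorem tendsto_radial {F : ℂ → ℂ} (hF : ContinuousOn F (Metric.closedBall 0 1)) {c : ℂ}
    (hc : ‖c‖ ≤ 1) : Tendsto (fun r : ℝ => F (r * c)) (𝓝[<] 1) (𝓝 (F c)) := by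
  have h1 : Tendsto (fun r : ℝ => (r : ℂ) * c) (𝓝[<] 1) (𝓝[Metric.closedBall 0 1] c) := by
    refine tendsto_nhdsWithin_iff.2 ⟨?_, ?_⟩
    · have : Continuous fun r : ℝ => (r : ℂ) * c := by fun_prop
      simpa using (this.tendsto 1).mono_left nhdsWithin_le_nhds
    · filter_upwards [Ioo_mem_nhdsLT (one_pos : (0 : ℝ) < 1)] with r hr
      rw [mem_closedBall_zero_iff, norm_mul, Complex.norm_real, Real.norm_of_nonneg hr.1.le]
      exact mul_le_one₀ hr.2.le (norm_nonneg _) hc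
  exact (hF c (by simpa using hc)).tendsto.comp h1

theorem abs_div_one_add_sq_le (a x : ℝ) : |a / (1 + x ^ 2)| ≤ |a| := by
  rw [abs_div, abs_of_pos (by positivity : 0 < 1 + x ^ 2)]
  exact div_le_self (abs_nonneg _) (by nlinarith [sq_nonneg x])

theorem continuous_re_div_one_add_sq {f : ℝ → ℂ} (hf : Continuous f) :
    Continuous fun x : ℝ => 2 * (f x).re / (1 + x ^ 2) :=
  Continuous.div (by fun_prop) (by fun_prop) one_add_sq_ne_zero

theorem polylog_two_neg_one_im : (polylog 2 (-1)).im = 0 := by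
  have h := polylog_conj 2 (-1)
  simp only [map_neg, map_one] at h
  exact Complex.conj_eq_iff_im.1 h.symm

/-- `-Li₂(-rz)` is the antiderivative, as `Li₁(-w) = -log(1+w)`; its argument runs from `-r` to
`-ri`. -/
theorem integral_re_log_one_add_mul_cayley {r : ℝ} (hr : r ∈ Ioo (0 : ℝ) 1) :
    ∫ x in (0 : ℝ)..1, 2 * (Complex.log (1 + (r : ℂ) * cayley x)).re / (1 + x ^ 2)
      = (polylog 2 (r * -1)).im - (polylog 2 (r * -Complex.I)).im := by
  have hr0 : (r : ℂ) ≠ 0 := by exact_mod_cast hr.1.ne'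
  have hn : ∀ x, ‖(-r : ℂ) * cayley x‖ < 1 := fun x => by
    rw [neg_mul, norm_neg, norm_mul_cayley hr.1.le]
    exact hr.2
  rw [integral_eq_sub_of_hasDerivAt (f := fun x => -(polylog 2 (-r * cayley x)).im)]
  · simp only [cayley_one, cayley_zero, mul_neg, neg_mul]
    ring
  · intro x _
    refine (hasDerivAt_im_comp_cayley (neg_ne_zero.2 hr0) (hasDerivAt_polylog 1 (hn x)
      (mul_ne_zero (neg_ne_zero.2 hr0) (cayley_ne_zero x)))).fun_neg.congr_deriv ?_
    rw [polylog_one_left (hn x), neg_mul, sub_neg_eq_add, Complex.neg_re]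
    ring
  · exact (continuous_re_div_one_add_sq (continuous_log_one_add_mul_cayley hr)).intervalIntegrable
      _ _

theorem integral_inv_one_add_sq_unit : ∫ x in (0 : ℝ)..1, 1 / (1 + x ^ 2) = Real.pi / 4 := by
  simp

theorem continuous_log_one_add_sq : Continuous fun x : ℝ => Real.log (1 + x ^ 2) :=
  Continuous.log (by fun_prop) one_add_sq_ne_zero

theorem integral_log_one_add_sq_div :
    ∫ x in (0 : ℝ)..1, Real.log (1 + x ^ 2) / (1 + x ^ 2)
      = Real.pi * Real.log 2 / 2 - catalanG := by
  have h1 := tendsto_integral_unit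
    (G := fun r x => 2 * (Complex.log (1 + (r : ℂ) * cayley x)).re / (1 + x ^ 2))
    (g := fun x => 2 * (Complex.log (1 + cayley x)).re / (1 + x ^ 2)) 10
    (fun r hr => (continuous_re_div_one_add_sq
      (continuous_log_one_add_mul_cayley hr)).continuousOn)
    (fun r hr x hx => by
      refine (abs_div_one_add_sq_le _ _).trans ?_
      have h2 := (Complex.abs_re_le_norm _).trans
        (norm_log_one_add_mul_cayley_le hr.1.le hr.2.le (Ioc_subset_Icc_self hx))
      rw [abs_mul, abs_two]
      nlinarith [abs_nonneg (Real.log x)])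
    (fun x hx => ((Complex.continuous_re.tendsto _).comp
      (tendsto_log_one_add_mul_cayley (Ioc_subset_Icc_self hx))).const_mul 2 |>.div_const _)
  have h2 : Tendsto (fun r : ℝ => (polylog 2 (r * -1)).im - (polylog 2 (r * -Complex.I)).im)
      (𝓝[<] 1) (𝓝 ((polylog 2 (-1)).im - (polylog 2 (-Complex.I)).im)) :=
    ((Complex.continuous_im.tendsto _).comp
      (tendsto_radial (continuousOn_polylog le_rfl) (by simp))).sub
    ((Complex.continuous_im.tendsto _).comp
      (tendsto_radial (continuousOn_polylog le_rfl) (by simp)))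
  have h3 := tendsto_nhds_unique h1 (h2.congr' (by
    filter_upwards [Ioo_mem_nhdsLT (one_pos : (0 : ℝ) < 1)] with r hr
    exact (integral_re_log_one_add_mul_cayley hr).symm))
  have h4 : ∫ x in (0 : ℝ)..1, 2 * (Complex.log (1 + cayley x)).re / (1 + x ^ 2)
      = ∫ x in (0 : ℝ)..1, (2 * Real.log 2 * (1 / (1 + x ^ 2))
        - Real.log (1 + x ^ 2) / (1 + x ^ 2)) := by
    refine integral_congr fun x _ => ?_
    simp only [log_one_add_cayley, ofReal_add_ofReal_mul_I_re]
    ring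
  rw [h4, intervalIntegral.integral_sub, intervalIntegral.integral_const_mul,
    integral_inv_one_add_sq_unit, polylog_two_neg_one_im, polylog_two_neg_I_im] at h3
  · linarith
  · exact Continuous.intervalIntegrable (continuous_const.mul (by
      simpa using continuous_inv_one_add_sq)) _ _
  · exact Continuous.intervalIntegrable (Continuous.div continuous_log_one_add_sq (by fun_prop)
      one_add_sq_ne_zero) _ _

theorem hasDerivAt_log_one_add_sq (x : ℝ) :
    HasDerivAt (fun x : ℝ => Real.log (1 + x ^ 2)) (2 * x / (1 + x ^ 2)) x := by
  have h := ((hasDerivAt_pow 2 x).const_add 1).log (one_add_sq_ne_zero x)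
  simpa using h

theorem arctanMoment_one : arctanMoment 1 = catalanG / 2 - Real.pi * Real.log 2 / 8 := by
  have i1 := (continuous_pow_mul_arctan_div 1).intervalIntegrable (μ := volume) 0 1
  have i2 : IntervalIntegrable (fun x : ℝ => Real.log (1 + x ^ 2) / (1 + x ^ 2)) volume 0 1 :=
    Continuous.intervalIntegrable (Continuous.div continuous_log_one_add_sq (by fun_prop)
      one_add_sq_ne_zero) _ _
  have h := integral_eq_sub_of_hasDerivAt
    (f := fun x => Real.arctan x * Real.log (1 + x ^ 2) / 2)
    (fun x _ => (((Real.hasDerivAt_arctan x).fun_mul (hasDerivAt_log_one_add_sq x)).div_const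
      2).congr_deriv (by ring))
    (i1.add (i2.div_const 2))
  rw [intervalIntegral.integral_add i1 (i2.div_const 2), intervalIntegral.integral_div,
    integral_log_one_add_sq_div, ← arctanMoment] at h
  simp only [Real.arctan_one, Real.arctan_zero] at h
  norm_num at h
  linarith

theorem legendreChi_one_re_mul_cayley {r : ℝ} (hr : r ∈ Ioo (0 : ℝ) 1) (x : ℝ) :
    (legendreChi 1 (r * cayley x)).re
      = ((Complex.log (1 + (r : ℂ) * cayley x)).re
        - (Complex.log (1 - (r : ℂ) * cayley x)).re) / 2 := by
  have h1 : ‖(r : ℂ) * cayley x‖ < 1 := by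
    rw [norm_mul_cayley hr.1.le]
    exact hr.2
  rw [legendreChi, polylog_one_left h1, polylog_one_left (by rwa [norm_neg]), sub_neg_eq_add]
  have : (2 : ℂ) = ((2 : ℝ) : ℂ) := by norm_num
  rw [this, Complex.div_ofReal_re, Complex.add_re, Complex.neg_re, sub_neg_eq_add]
  ring

/-- Parts on the arc: `Im χ₂` integrates the logarithmic factor, and `Re χ₃ / 2` cancels the
remaining term `Im χ₂ / (1+x²)`. -/
theorem integral_arctan_mul_re_log_mul_cayley {r : ℝ} (hr : r ∈ Ioo (0 : ℝ) 1) :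
    ∫ x in (0 : ℝ)..1, Real.arctan x * (((Complex.log (1 + (r : ℂ) * cayley x)).re
        - (Complex.log (1 - (r : ℂ) * cayley x)).re) / (1 + x ^ 2))
      = Real.pi / 4 * (legendreChi 2 (r * Complex.I)).im
        + (legendreChi 3 (r * Complex.I)).re / 2 - (legendreChi 3 (r * 1)).re / 2 := by
  have hr0 : (r : ℂ) ≠ 0 := by exact_mod_cast hr.1.ne'
  have hn : ∀ x, ‖(r : ℂ) * cayley x‖ < 1 := fun x => by
    rw [norm_mul_cayley hr.1.le]
    exact hr.2
  rw [integral_eq_sub_of_hasDerivAt (f := fun x => Real.arctan x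
    * (legendreChi 2 (r * cayley x)).im + (legendreChi 3 (r * cayley x)).re / 2)]
  · simp only [cayley_one, cayley_zero, Real.arctan_one, Real.arctan_zero]
    ring
  · intro x _
    have h0 := mul_ne_zero hr0 (cayley_ne_zero x)
    refine (((Real.hasDerivAt_arctan x).fun_mul (hasDerivAt_im_comp_cayley hr0
      (hasDerivAt_legendreChi 1 (hn x) h0))).fun_add ((hasDerivAt_re_comp_cayley hr0
        (hasDerivAt_legendreChi 2 (hn x) h0)).div_const 2)).congr_deriv ?_
    rw [legendreChi_one_re_mul_cayley hr]
    ring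
  · refine Continuous.intervalIntegrable (Real.continuous_arctan.mul (Continuous.div ?_
      (by fun_prop) one_add_sq_ne_zero)) _ _
    exact (Complex.continuous_re.comp (continuous_log_one_add_mul_cayley hr)).sub
      (Complex.continuous_re.comp (continuous_log_one_sub_mul_cayley hr))

theorem abs_arctan_le_two (x : ℝ) : |Real.arctan x| ≤ 2 := by
  have h1 := Real.neg_pi_div_two_lt_arctan x
  have h2 := Real.arctan_lt_pi_div_two x
  have h3 := Real.pi_lt_d2
  exact abs_le.2 ⟨by linarith, by linarith⟩

theorem logArctanMoment_zero :
    logArctanMoment 0 = (-(4 * catalanG * Real.pi) + 7 * zeta3) / 16 := by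
  have h1 := tendsto_integral_unit
    (G := fun r x => Real.arctan x * (((Complex.log (1 + (r : ℂ) * cayley x)).re
        - (Complex.log (1 - (r : ℂ) * cayley x)).re) / (1 + x ^ 2)))
    (g := fun x => Real.arctan x * (((Complex.log (1 + cayley x)).re
        - (Complex.log (1 - cayley x)).re) / (1 + x ^ 2))) 20
    (fun r hr => (Real.continuous_arctan.mul (Continuous.div
      ((Complex.continuous_re.comp (continuous_log_one_add_mul_cayley hr)).sub
        (Complex.continuous_re.comp (continuous_log_one_sub_mul_cayley hr)))
      (by fun_prop) one_add_sq_ne_zero)).continuousOn)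
    (fun r hr x hx => by
      have h2 := (Complex.abs_re_le_norm _).trans
        (norm_log_one_add_mul_cayley_le hr.1.le hr.2.le (Ioc_subset_Icc_self hx))
      have h3 := (Complex.abs_re_le_norm _).trans
        (norm_log_one_sub_mul_cayley_le hr.1.le hr.2.le hx)
      rw [abs_mul]
      calc _ ≤ 2 * (5 + (5 + |Real.log x|)) :=
            mul_le_mul (abs_arctan_le_two x) ((abs_div_one_add_sq_le _ _).trans
              ((abs_sub _ _).trans (add_le_add h2 h3))) (abs_nonneg _) zero_le_two
        _ ≤ _ := by nlinarith [abs_nonneg (Real.log x)])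
    (fun x hx => ((((Complex.continuous_re.tendsto _).comp
      (tendsto_log_one_add_mul_cayley (Ioc_subset_Icc_self hx))).sub
      ((Complex.continuous_re.tendsto _).comp
        (tendsto_log_one_sub_mul_cayley hx.1))).div_const _).const_mul _)
  have h2 : Tendsto (fun r : ℝ => Real.pi / 4 * (legendreChi 2 (r * Complex.I)).im
        + (legendreChi 3 (r * Complex.I)).re / 2 - (legendreChi 3 (r * 1)).re / 2)
      (𝓝[<] 1) (𝓝 (Real.pi / 4 * (legendreChi 2 Complex.I).im
        + (legendreChi 3 Complex.I).re / 2 - (legendreChi 3 1).re / 2)) :=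
    ((((Complex.continuous_im.tendsto _).comp
      (tendsto_radial (continuousOn_legendreChi le_rfl) (by simp))).const_mul _).add
    (((Complex.continuous_re.tendsto _).comp
      (tendsto_radial (continuousOn_legendreChi (by norm_num)) (by simp))).div_const _)).sub
    (((Complex.continuous_re.tendsto _).comp
      (tendsto_radial (continuousOn_legendreChi (by norm_num)) (by simp))).div_const _)
  have h3 := tendsto_nhds_unique h1 (h2.congr' (by
    filter_upwards [Ioo_mem_nhdsLT (one_pos : (0 : ℝ) < 1)] with r hr
    exact (integral_arctan_mul_re_log_mul_cayley hr).symm))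
  -- On the unit arc `Re log((1+z)/(1-z)) = -log x`.
  have h4 : ∫ x in (0 : ℝ)..1, Real.arctan x * (((Complex.log (1 + cayley x)).re
        - (Complex.log (1 - cayley x)).re) / (1 + x ^ 2)) = -logArctanMoment 0 := by
    rw [logArctanMoment, ← intervalIntegral.integral_neg]
    refine integral_congr fun x hx => ?_
    rw [uIcc_of_le zero_le_one] at hx
    rcases hx.1.eq_or_lt with h0 | h0
    · simp [← h0]
    · simp only [log_one_add_cayley, log_one_sub_cayley h0, ofReal_add_ofReal_mul_I_re]
      ring
  rw [h4, legendreChi_two_I, legendreChi_three_I_re, legendreChi_three_one_re] at h3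
  simp at h3
  linarith

/-! ### The integral of `arctan x log(1+x²) / x` -/

/-- This is `arctan x / x` continued through `0`. It supplies continuity at `0` of `arctan x log x`
and of `arctan x log(1+x²)/x`, both with value `0` there. -/
theorem continuous_dslope_arctan : Continuous (dslope Real.arctan 0) := by
  refine continuous_iff_continuousAt.2 fun x => ?_
  rcases eq_or_ne x 0 with rfl | hx
  · exact continuousAt_dslope_same.2 (Real.differentiableAt_arctan 0)
  · exact (continuousAt_dslope_of_ne hx).2 Real.continuous_arctan.continuousAt

theorem mul_dslope_arctan (x : ℝ) : x * dslope Real.arctan 0 x = Real.arctan x := by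
  simpa using sub_smul_dslope Real.arctan 0 x

theorem continuous_arctan_mul_log : Continuous fun x => Real.arctan x * Real.log x := by
  refine (continuous_dslope_arctan.mul Real.continuous_mul_log).congr fun x => ?_
  rw [Pi.mul_apply, ← mul_assoc, mul_comm (dslope _ _ _), mul_dslope_arctan]

theorem continuous_arctan_mul_log_div :
    Continuous fun x => Real.arctan x * Real.log (1 + x ^ 2) / x := by
  refine (continuous_dslope_arctan.mul continuous_log_one_add_sq).congr fun x => ?_
  rcases eq_or_ne x 0 with rfl | hx
  · simp
  · rw [Pi.mul_apply, ← mul_dslope_arctan x]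
    field_simp

/-- `∫₀¹ arctan x log(1+x²) / x`. -/
noncomputable def arctanLogIntegral : ℝ :=
  ∫ x in (0 : ℝ)..1, Real.arctan x * Real.log (1 + x ^ 2) / x

/-- Parts with `arctan x · log x · log(1+x²) / 2`, which vanishes at both endpoints. -/
theorem logArctanMoment_one_eq :
    logArctanMoment 1 = -(∫ x in (0 : ℝ)..1, Real.log (1 + x ^ 2) / (1 + x ^ 2) * Real.log x) / 2
      - arctanLogIntegral / 2 := by
  have i1 := intervalIntegrable_mul_log (continuous_pow_mul_arctan_div 1)
  have i2 : IntervalIntegrable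
      (fun x : ℝ => Real.log (1 + x ^ 2) / (1 + x ^ 2) * Real.log x) volume 0 1 :=
    intervalIntegrable_mul_log (Continuous.div continuous_log_one_add_sq (by fun_prop)
      one_add_sq_ne_zero)
  have i3 := continuous_arctan_mul_log_div.intervalIntegrable (μ := volume) 0 1
  have h := integral_eq_sub_of_hasDerivAt_of_le zero_le_one
    (f := fun x => Real.arctan x * Real.log x * Real.log (1 + x ^ 2) / 2)
    ((continuous_arctan_mul_log.mul continuous_log_one_add_sq).div_const 2).continuousOn
    (fun x hx => ((((Real.hasDerivAt_arctan x).fun_mul (Real.hasDerivAt_log hx.1.ne')).fun_mul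
      (hasDerivAt_log_one_add_sq x)).div_const 2).congr_deriv (by ring))
    ((i1.add (i2.div_const 2)).add (i3.div_const 2))
  rw [intervalIntegral.integral_add (i1.add (i2.div_const 2)) (i3.div_const 2),
    intervalIntegral.integral_add i1 (i2.div_const 2), intervalIntegral.integral_div,
    intervalIntegral.integral_div, ← logArctanMoment, ← arctanLogIntegral] at h
  simp only [Real.log_one, Real.log_zero, mul_zero, zero_mul, zero_div, sub_zero] at h
  linarith

/-! ### Contour shift for `log((1-z)/(1+z)) log(1+z) / z` -/

/-- `log((1-z)/(1+z)) log(1+z)` on the unit disc. -/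
noncomputable def logProduct (z : ℂ) : ℂ :=
  (Complex.log (1 - z) - Complex.log (1 + z)) * Complex.log (1 + z)

theorem one_sub_mem_slitPlane {z : ℂ} (hz : ‖z‖ < 1) : 1 - z ∈ Complex.slitPlane := by
  rw [sub_eq_add_neg]
  exact Complex.mem_slitPlane_of_norm_lt_one (by rwa [norm_neg])

theorem differentiableOn_logProduct : DifferentiableOn ℂ logProduct (Metric.ball 0 1) := by
  intro z hz
  rw [mem_ball_zero_iff] at hz
  have h1 : DifferentiableAt ℂ (fun z => Complex.log (1 - z)) z :=
    DifferentiableAt.clog (by fun_prop) (one_sub_mem_slitPlane hz)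
  have h2 : DifferentiableAt ℂ (fun z => Complex.log (1 + z)) z :=
    DifferentiableAt.clog (by fun_prop) (Complex.mem_slitPlane_of_norm_lt_one hz)
  exact ((h1.sub h2).mul h2).differentiableWithinAt

theorem logProduct_zero : logProduct 0 = 0 := by simp [logProduct]

/-- `logProduct` vanishes at `0`, so the quotient by `z` has a removable singularity, and a
holomorphic function on a disc has a primitive. -/
theorem exists_primitive_logProduct_div :
    ∃ Θ : ℂ → ℂ, ContinuousOn Θ (Metric.ball 0 1) ∧
      ∀ z, ‖z‖ < 1 → z ≠ 0 → HasDerivAt Θ (logProduct z / z) z := by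
  have h1 : DifferentiableOn ℂ (dslope logProduct 0) (Metric.ball 0 1) :=
    (Complex.differentiableOn_dslope (Metric.ball_mem_nhds 0 one_pos)).2
      differentiableOn_logProduct
  obtain ⟨Θ, hΘ⟩ := h1.isExactOn_ball
  refine ⟨Θ, fun z hz => (hΘ z hz).continuousAt.continuousWithinAt, fun z hz h0 => ?_⟩
  refine (hΘ z (by simpa using hz)).congr_deriv ?_
  rw [dslope_of_ne _ h0, slope_def_field, logProduct_zero, sub_zero, sub_zero]

theorem logProduct_ofReal_im {x : ℝ} (h1 : -1 < x) (h2 : x < 1) : (logProduct x).im = 0 := by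
  have e1 : (1 - (x : ℂ)) = ((1 - x : ℝ) : ℂ) := by push_cast; ring
  have e2 : (1 + (x : ℂ)) = ((1 + x : ℝ) : ℂ) := by push_cast; ring
  rw [logProduct, e1, e2, ← Complex.ofReal_log (by linarith), ← Complex.ofReal_log (by linarith),
    ← Complex.ofReal_sub, ← Complex.ofReal_mul, Complex.ofReal_im]

theorem logProduct_mul_I_im (x : ℝ) :
    (logProduct (x * Complex.I)).im = -(Real.arctan x * Real.log (1 + x ^ 2)) := by
  rw [logProduct, log_one_add_mul_I, log_one_sub_mul_I]
  simp only [Complex.mul_im, Complex.sub_im, Complex.sub_re, Complex.add_re, Complex.add_im,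
    Complex.re_ofReal_mul, Complex.ofReal_re, Complex.ofReal_im,
    Complex.I_re, Complex.I_im]
  ring

/-- Cauchy's theorem for the quarter disc, in terms of a primitive `Θ`: the arc integral is `Im
Θ(ri) - Im Θ(r)`, recomputed along the two radii from `0`. -/
theorem integral_re_logProduct_mul_cayley {r : ℝ} (hr : r ∈ Ioo (0 : ℝ) 1) :
    ∫ x in (0 : ℝ)..1, 2 * (logProduct (r * cayley x)).re / (1 + x ^ 2)
      = -∫ x in (0 : ℝ)..r, Real.arctan x * Real.log (1 + x ^ 2) / x := by
  obtain ⟨Θ, hc, hΘ⟩ := exists_primitive_logProduct_div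
  have hr0 : (r : ℂ) ≠ 0 := by exact_mod_cast hr.1.ne'
  have hn : ∀ x, ‖(r : ℂ) * cayley x‖ < 1 := fun x => by
    rw [norm_mul_cayley hr.1.le]
    exact hr.2
  have hlog : Continuous fun x => logProduct (r * cayley x) :=
    ((continuous_log_one_sub_mul_cayley hr).sub (continuous_log_one_add_mul_cayley hr)).mul
      (continuous_log_one_add_mul_cayley hr)
  have h1 := integral_eq_sub_of_hasDerivAt (a := 0) (b := 1)
    (f := fun x => (Θ (r * cayley x)).im)
    (fun x _ => hasDerivAt_im_comp_cayley hr0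
      (hΘ _ (hn x) (mul_ne_zero hr0 (cayley_ne_zero x))))
    ((continuous_re_div_one_add_sq hlog).intervalIntegrable _ _)
  have hray : ∀ c : ℂ, ‖c‖ = 1 → ∀ f : ℝ → ℝ, IntervalIntegrable f volume 0 r →
      (∀ x ∈ Ioo 0 r, (logProduct (x * c)).im / x = f x) →
      ∫ x in (0 : ℝ)..r, f x = (Θ (r * c)).im - (Θ 0).im := by
    intro c hc1 f hf hfx
    have hnorm : ∀ x ∈ Icc 0 r, ‖(x : ℂ) * c‖ < 1 := fun x hx => by
      rw [norm_mul, hc1, mul_one, Complex.norm_real, Real.norm_of_nonneg hx.1]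
      exact hx.2.trans_lt hr.2
    rw [integral_eq_sub_of_hasDerivAt_of_le hr.1.le (f := fun x : ℝ => (Θ (x * c)).im) _ _ hf]
    · simp
    · refine Complex.continuous_im.comp_continuousOn (hc.comp (by fun_prop) fun x hx => ?_)
      simpa using hnorm x hx
    · intro x hx
      have hx0 : (x : ℂ) ≠ 0 := by exact_mod_cast hx.1.ne'
      have hc0 : c ≠ 0 := by
        rw [← norm_ne_zero_iff, hc1]
        exact one_ne_zero
      have hd : HasDerivAt (fun x : ℝ => (x : ℂ) * c) c x := by
        simpa using (Complex.ofRealCLM.hasDerivAt (x := x)).mul_const c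
      have h2 := Complex.imCLM.hasFDerivAt.comp_hasDerivAt x
        ((hΘ _ (hnorm x (Ioo_subset_Icc_self hx)) (mul_ne_zero hx0 hc0)).comp x hd)
      refine h2.congr_deriv ?_
      rw [← hfx x hx, ← Complex.div_ofReal_im, Complex.imCLM_apply]
      congr 1
      field_simp
  -- The real radius contributes nothing, since `logProduct` is real there; thus `Im Θ(r) = Im
  -- Θ(0)`.
  have h2 := hray 1 (by simp) (fun _ => 0) intervalIntegrable_const (fun x hx => by
    rw [mul_one, logProduct_ofReal_im (by linarith [hx.1]) (hx.2.trans hr.2), zero_div])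
  have h3 := hray Complex.I (by simp) (fun x => -(Real.arctan x * Real.log (1 + x ^ 2) / x))
    (continuous_arctan_mul_log_div.neg.intervalIntegrable _ _) (fun x _ => by
      rw [logProduct_mul_I_im, neg_div])
  rw [h1, cayley_one, cayley_zero, ← intervalIntegral.integral_neg, h3]
  simp at h2 ⊢
  linarith

theorem integral_log_one_add_sq_div_mul_log :
    ∫ x in (0 : ℝ)..1, Real.log (1 + x ^ 2) / (1 + x ^ 2) * Real.log x
      = arctanLogIntegral - 2 * Real.log 2 * catalanG + Real.pi ^ 3 / 32 := by
  have h1 := tendsto_integral_unit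
    (G := fun r x => 2 * (logProduct (r * cayley x)).re / (1 + x ^ 2))
    (g := fun x => 2 * (logProduct (cayley x)).re / (1 + x ^ 2)) 100
    (fun r hr => (continuous_re_div_one_add_sq
      (((continuous_log_one_sub_mul_cayley hr).sub (continuous_log_one_add_mul_cayley hr)).mul
        (continuous_log_one_add_mul_cayley hr))).continuousOn)
    (fun r hr x hx => by
      refine (abs_div_one_add_sq_le _ _).trans ?_
      have h2 := norm_log_one_add_mul_cayley_le hr.1.le hr.2.le (Ioc_subset_Icc_self hx)
      have h3 := norm_log_one_sub_mul_cayley_le hr.1.le hr.2.le hx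
      have h4 : ‖logProduct (r * cayley x)‖ ≤ (5 + |Real.log x| + 5) * 5 := by
        rw [logProduct, norm_mul]
        exact mul_le_mul ((norm_sub_le _ _).trans (add_le_add h3 h2)) h2 (norm_nonneg _)
          (by positivity)
      have h5 := (Complex.abs_re_le_norm _).trans h4
      rw [abs_mul, abs_two]
      nlinarith [abs_nonneg (Real.log x)])
    (fun x hx => by
      have h2 := tendsto_log_one_add_mul_cayley (Ioc_subset_Icc_self hx)
      exact (((Complex.continuous_re.tendsto _).comp
        (((tendsto_log_one_sub_mul_cayley hx.1).sub h2).mul h2)).const_mul 2).div_const _)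
  have h2 : Tendsto (fun r : ℝ => -∫ x in (0 : ℝ)..r, Real.arctan x * Real.log (1 + x ^ 2) / x)
      (𝓝[<] 1) (𝓝 (-arctanLogIntegral)) := by
    have hc := continuous_primitive (f := fun x => Real.arctan x * Real.log (1 + x ^ 2) / x)
      (μ := volume) (fun a b => continuous_arctan_mul_log_div.intervalIntegrable _ _) 0
    exact (hc.neg.tendsto 1).mono_left nhdsWithin_le_nhds
  have h3 := tendsto_nhds_unique h1 (h2.congr' (by
    filter_upwards [Ioo_mem_nhdsLT (one_pos : (0 : ℝ) < 1)] with r hr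
    exact (integral_re_logProduct_mul_cayley hr).symm))
  have i1 : IntervalIntegrable (fun x : ℝ => 2 * Real.log 2 * (Real.log x / (1 + x ^ 2)))
      volume 0 1 := by
    refine IntervalIntegrable.const_mul ?_ _
    refine (intervalIntegrable_mul_log continuous_inv_one_add_sq).congr_ae ?_
    exact Eventually.of_forall fun x => by simp only; ring
  have i2 : IntervalIntegrable
      (fun x : ℝ => Real.log (1 + x ^ 2) / (1 + x ^ 2) * Real.log x) volume 0 1 :=
    intervalIntegrable_mul_log (Continuous.div continuous_log_one_add_sq (by fun_prop)
      one_add_sq_ne_zero)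
  have i3 := ((continuous_pow_mul_arctan_div 0).intervalIntegrable (μ := volume) 0 1).const_mul
    Real.pi
  -- On the arc the product is `(log x - iπ/2)(log 2 - log(1+x²)/2 + i arctan x)`; the term `π
  -- arctan x` in twice its real part leads to `π A(0) = π³/32`.
  have h4 : ∫ x in (0 : ℝ)..1, 2 * (logProduct (cayley x)).re / (1 + x ^ 2)
      = ∫ x in (0 : ℝ)..1, (2 * Real.log 2 * (Real.log x / (1 + x ^ 2))
        - Real.log (1 + x ^ 2) / (1 + x ^ 2) * Real.log x
        + Real.pi * (x ^ 0 * Real.arctan x / (1 + x ^ 2))) := by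
    refine integral_congr_ae (Eventually.of_forall fun x hx => ?_)
    rw [uIoc_of_le zero_le_one] at hx
    rw [logProduct, log_one_add_cayley, log_one_sub_cayley hx.1, Complex.mul_re, Complex.sub_re,
      Complex.sub_im, ofReal_add_ofReal_mul_I_re, ofReal_add_ofReal_mul_I_im,
      ofReal_add_ofReal_mul_I_re, ofReal_add_ofReal_mul_I_im]
    ring
  rw [h4, intervalIntegral.integral_add (i1.sub i2) i3, intervalIntegral.integral_sub i1 i2,
    intervalIntegral.integral_const_mul, intervalIntegral.integral_const_mul, integral_log_div,
    ← arctanMoment, arctanMoment_zero] at h3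
  linarith

/-! ### Landen's transformation along the imaginary axis -/

theorem norm_landen_lt {x : ℝ} (hx : 0 ≤ x) : ‖x * Complex.I / (1 + x * Complex.I)‖ < 1 := by
  have h1 : ‖1 + x * Complex.I‖ = Real.sqrt (1 + x ^ 2) := by
    simpa using Complex.norm_add_mul_I 1 x
  rw [norm_div, h1, norm_mul, Complex.norm_I, mul_one, Complex.norm_real,
    Real.norm_of_nonneg hx, div_lt_one (by positivity)]
  exact Real.lt_sqrt_of_sq_lt (by linarith)

theorem hasDerivAt_ofReal_mul_I (x : ℝ) :
    HasDerivAt (fun x : ℝ => (x : ℂ) * Complex.I) Complex.I x := by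
  simpa using (Complex.ofRealCLM.hasDerivAt (x := x)).mul_const Complex.I

theorem one_add_mul_I_mem_slitPlane (x : ℝ) : 1 + x * Complex.I ∈ Complex.slitPlane := by
  left
  simp

theorem hasDerivAt_log_one_add_mul_I (x : ℝ) :
    HasDerivAt (fun x : ℝ => Complex.log (1 + x * Complex.I))
      (Complex.I / (1 + x * Complex.I)) x :=
  ((hasDerivAt_ofReal_mul_I x).const_add 1).clog_real (one_add_mul_I_mem_slitPlane x)

theorem hasDerivAt_polylog_neg_mul_I (s : ℕ) {x : ℝ} (hx : x ∈ Ioo (0 : ℝ) 1) :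
    HasDerivAt (fun x : ℝ => polylog (s + 1) (-(x * Complex.I)))
      (polylog s (-(x * Complex.I)) / x) x := by
  have hx0 : (x : ℂ) ≠ 0 := by exact_mod_cast hx.1.ne'
  have h := (hasDerivAt_polylog s (z := -(x * Complex.I)) (by
    simpa [abs_of_pos hx.1] using hx.2) (neg_ne_zero.2 (mul_ne_zero hx0 Complex.I_ne_zero))).comp x
    (hasDerivAt_ofReal_mul_I x).fun_neg
  refine h.congr_deriv ?_
  have := Complex.I_ne_zero
  field_simp

theorem hasDerivAt_polylog_landen (s : ℕ) {x : ℝ} (hx : 0 < x) :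
    HasDerivAt (fun x : ℝ => polylog (s + 1) (x * Complex.I / (1 + x * Complex.I)))
      (polylog s (x * Complex.I / (1 + x * Complex.I)) / (x * (1 + x * Complex.I))) x := by
  have hx0 : (x : ℂ) ≠ 0 := by exact_mod_cast hx.ne'
  have hI := Complex.I_ne_zero
  have hu := one_add_mul_I_ne_zero x
  have h := (hasDerivAt_polylog s (norm_landen_lt hx.le)
    (div_ne_zero (mul_ne_zero hx0 hI) hu)).comp x
    ((hasDerivAt_ofReal_mul_I x).fun_div ((hasDerivAt_ofReal_mul_I x).const_add 1) hu)
  refine h.congr_deriv ?_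
  field_simp
  ring

theorem polylog_one_landen {x : ℝ} (hx : 0 ≤ x) :
    polylog 1 (x * Complex.I / (1 + x * Complex.I)) = Complex.log (1 + x * Complex.I) := by
  have hu := one_add_mul_I_ne_zero x
  have h1 : 1 - x * Complex.I / (1 + x * Complex.I) = (1 + x * Complex.I)⁻¹ := by
    field_simp
    ring
  rw [polylog_one_left (norm_landen_lt hx), h1, Complex.log_inv, neg_neg]
  exact Complex.slitPlane_arg_ne_pi (one_add_mul_I_mem_slitPlane x)

theorem polylog_one_neg_mul_I {x : ℝ} (hx : x ∈ Ioo (0 : ℝ) 1) :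
    polylog 1 (-(x * Complex.I)) = -Complex.log (1 + x * Complex.I) := by
  rw [polylog_one_left (by simpa [abs_of_pos hx.1] using hx.2), sub_neg_eq_add]

theorem continuousOn_polylog_landen {s : ℕ} (hs : 2 ≤ s) :
    ContinuousOn (fun x : ℝ => polylog s (x * Complex.I / (1 + x * Complex.I))) (Icc 0 1) := by
  refine (continuousOn_polylog hs).comp (Continuous.continuousOn ?_) fun x hx => ?_
  · exact Continuous.div (by fun_prop) (by fun_prop) one_add_mul_I_ne_zero
  · simpa using (norm_landen_lt hx.1).le

theorem continuousOn_polylog_neg_mul_I {s : ℕ} (hs : 2 ≤ s) :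
    ContinuousOn (fun x : ℝ => polylog s (-(x * Complex.I))) (Icc 0 1) := by
  refine (continuousOn_polylog hs).comp (by fun_prop) fun x hx => ?_
  simpa [abs_of_nonneg hx.1] using hx.2

theorem continuous_log_one_add_mul_I :
    Continuous fun x : ℝ => Complex.log (1 + x * Complex.I) :=
  Continuous.clog (by fun_prop) one_add_mul_I_mem_slitPlane

/-- The difference of the two sides has zero derivative in `x` and vanishes at `x = 0`. -/
theorem polylog_two_landen {x : ℝ} (hx : x ∈ Icc (0 : ℝ) 1) :
    polylog 2 (x * Complex.I / (1 + x * Complex.I))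
      = -polylog 2 (-(x * Complex.I)) - Complex.log (1 + x * Complex.I) ^ 2 / 2 := by
  have hsub : Icc 0 x ⊆ Icc (0 : ℝ) 1 := Icc_subset_Icc_right hx.2
  have h := integral_eq_sub_of_hasDerivAt_of_le hx.1
    (f := fun x : ℝ => polylog 2 (x * Complex.I / (1 + x * Complex.I))
      + polylog 2 (-(x * Complex.I)) + Complex.log (1 + x * Complex.I) ^ 2 / 2)
    (f' := fun _ => 0)
    ((((continuousOn_polylog_landen le_rfl).mono hsub).add
      ((continuousOn_polylog_neg_mul_I le_rfl).mono hsub)).add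
      ((continuous_log_one_add_mul_I.pow 2).div_const 2).continuousOn)
    (fun y hy => by
      have hy1 : y ∈ Ioo (0 : ℝ) 1 := ⟨hy.1, hy.2.trans_le hx.2⟩
      have hy0 : (y : ℂ) ≠ 0 := by exact_mod_cast hy.1.ne'
      have hu := one_add_mul_I_ne_zero y
      refine (((hasDerivAt_polylog_landen 1 hy.1).fun_add
        (hasDerivAt_polylog_neg_mul_I 1 hy1)).fun_add
        (((hasDerivAt_log_one_add_mul_I y).fun_pow 2).div_const 2)).congr_deriv ?_
      rw [polylog_one_landen hy.1.le, polylog_one_neg_mul_I hy1]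
      push_cast
      field_simp
      ring)
    intervalIntegrable_const
  simp only [intervalIntegral.integral_zero, Complex.ofReal_zero, zero_mul, zero_div, neg_zero,
    polylog_zero_right, add_zero, Complex.log_one] at h
  linear_combination -h

theorem arctanLogIntegral_eq :
    arctanLogIntegral = 2 * W3 - Real.pi * Real.log 2 ^ 2 / 16 + catalanG * Real.log 2
      - 3 * Real.pi ^ 3 / 64 := by
  -- An antiderivative of `log²(1+ix)/(2x)`, by the dilogarithm identity above. The imaginary part
  -- of that integrand is half the one defining `arctanLogIntegral`.
  have hcont : ContinuousOn (fun x : ℝ => polylog 3 (x * Complex.I / (1 + x * Complex.I))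
      + polylog 3 (-(x * Complex.I)) - Complex.log (1 + x * Complex.I) ^ 3 / 6
      - polylog 2 (-(x * Complex.I)) * Complex.log (1 + x * Complex.I)) (Icc 0 1) :=
    (((continuousOn_polylog_landen (by norm_num)).add
      (continuousOn_polylog_neg_mul_I (by norm_num))).sub
      ((continuous_log_one_add_mul_I.pow 3).div_const 6).continuousOn).sub
      ((continuousOn_polylog_neg_mul_I le_rfl).mul continuous_log_one_add_mul_I.continuousOn)
  have h := integral_eq_sub_of_hasDerivAt_of_le zero_le_one
    (Complex.continuous_im.comp_continuousOn hcont)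
    (f' := fun x => Real.arctan x * Real.log (1 + x ^ 2) / x / 2)
    (fun x hx => by
      have hx0 : (x : ℂ) ≠ 0 := by exact_mod_cast hx.1.ne'
      have hu := one_add_mul_I_ne_zero x
      have h1 := ((((hasDerivAt_polylog_landen 2 hx.1).fun_add
        (hasDerivAt_polylog_neg_mul_I 2 hx)).fun_sub
        (((hasDerivAt_log_one_add_mul_I x).fun_pow 3).div_const 6)).fun_sub
        ((hasDerivAt_polylog_neg_mul_I 1 hx).fun_mul (hasDerivAt_log_one_add_mul_I x)))
      refine (Complex.imCLM.hasFDerivAt.comp_hasDerivAt x (h1.congr_deriv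
        (g' := ((1 / (2 * x) : ℝ) : ℂ) * (Complex.log (1 + x * Complex.I) ^ 2))
        ?_)).congr_deriv ?_
      · rw [polylog_two_landen (Ioo_subset_Icc_self hx), polylog_one_neg_mul_I hx]
        push_cast
        field_simp
        ring
      · have hx' := hx.1.ne'
        rw [Complex.imCLM_apply, Complex.im_ofReal_mul, log_one_add_mul_I, sq, Complex.mul_im,
          ofReal_add_ofReal_mul_I_re, ofReal_add_ofReal_mul_I_im]
        field_simp
        ring)
    ((continuous_arctan_mul_log_div.div_const 2).intervalIntegrable _ _)
  rw [intervalIntegral.integral_div, ← arctanLogIntegral] at h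
  have hz : ((1 : ℝ) : ℂ) * Complex.I / (1 + (1 : ℝ) * Complex.I) = (1 + Complex.I) / 2 := by
    rw [div_eq_div_iff (one_add_mul_I_ne_zero 1) two_ne_zero]
    push_cast
    linear_combination -Complex.I_sq
  have hl := log_one_add_mul_I 1
  rw [Real.arctan_one] at hl
  simp only [Function.comp, hz, hl, Complex.sub_im, Complex.add_im] at h
  have hpow : ((((Real.log (1 + 1 ^ 2) / 2 : ℝ) : ℂ) + (Real.pi / 4 : ℝ) * Complex.I) ^ 3 / 6).im
      = (3 * (Real.log 2 / 2) ^ 2 * (Real.pi / 4) - (Real.pi / 4) ^ 3) / 6 := by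
    have : (((Real.log (1 + 1 ^ 2) / 2 : ℝ) : ℂ) + (Real.pi / 4 : ℝ) * Complex.I) ^ 3 / 6
        = ((((Real.log 2 / 2) ^ 3 - 3 * (Real.log 2 / 2) * (Real.pi / 4) ^ 2) / 6 : ℝ) : ℂ)
          + (((3 * (Real.log 2 / 2) ^ 2 * (Real.pi / 4) - (Real.pi / 4) ^ 3) / 6 : ℝ) : ℂ)
            * Complex.I := by
      rw [show (1 : ℝ) + 1 ^ 2 = 2 by norm_num]
      push_cast
      linear_combination (((Real.log 2 : ℝ) / 2) * (Real.pi / 4) ^ 2 / 2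
        + (Real.pi / 4) ^ 3 * Complex.I / 6) * Complex.I_sq
    rw [this, ofReal_add_ofReal_mul_I_im]
  rw [hpow, Complex.mul_im, ofReal_add_ofReal_mul_I_re, ofReal_add_ofReal_mul_I_im, ← W3] at h
  simp only [Complex.ofReal_one, one_mul, polylog_three_neg_I_im, polylog_two_neg_I_re,
    polylog_two_neg_I_im, Complex.ofReal_zero, zero_mul, zero_div, neg_zero, polylog_zero_right,
    add_zero, Complex.log_one, Complex.zero_im] at h
  norm_num at h
  linarith

theorem logArctanMoment_one :
    logArctanMoment 1
      = (3 * Real.pi ^ 3 + 6 * Real.pi * Real.log 2 ^ 2 - 192 * W3) / 96 := by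
  rw [logArctanMoment_one_eq, integral_log_one_add_sq_div_mul_log, arctanLogIntegral_eq]
  ring

/-! ### Closed forms -/

theorem arctanMoment_odd (k : ℕ) :
    arctanMoment (2 * k + 1)
      = (∑ j ∈ Finset.Icc 1 k, (-1) ^ (j + 1) *
            ((Real.pi + harmonicReal ((2 * (k : ℝ) - 1 - 2 * (j : ℝ)) / 4)
                - harmonicReal ((2 * (k : ℝ) + 1 - 2 * (j : ℝ)) / 4))
              / (8 * ((k : ℝ) + 1 - (j : ℝ)))))
          + (-1) ^ k / 8 * (4 * catalanG - Real.pi * Real.log 2) := by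
  rw [eq_sum_of_add_two_eq_sub arctanMoment_add_two, arctanMoment_one]
  congr 1
  · refine Finset.sum_congr rfl fun j hj => ?_
    have hj := (Finset.mem_Icc.1 hj).2
    rw [integral_pow_mul_arctan, Nat.cast_sub (by omega), harmonicReal, harmonicReal]
    push_cast
    congr 1
    ring_nf
  · ring

theorem arctanMoment_even (k : ℕ) :
    arctanMoment (2 * k + 2)
      = (∑ j ∈ Finset.Icc 1 (k + 1), (-1) ^ (j + 1) *
            ((Real.pi + harmonicReal (((k : ℝ) - (j : ℝ)) / 2)
                - harmonicReal (((k : ℝ) + 1 - (j : ℝ)) / 2))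
              / (4 * (2 * (k : ℝ) + 3 - 2 * (j : ℝ)))))
          + (-1) ^ (k + 1) * Real.pi ^ 2 / 32 := by
  have h := eq_sum_of_add_two_eq_sub arctanMoment_add_two 0 (k + 1)
  rw [arctanMoment_zero] at h
  refine h.trans (congrArg₂ _ ?_ (by ring))
  refine Finset.sum_congr rfl fun j hj => ?_
  have hj := (Finset.mem_Icc.1 hj).2
  rw [integral_pow_mul_arctan, Nat.cast_sub (by omega), harmonicReal, harmonicReal]
  push_cast
  congr 1
  ring_nf

theorem logArctanMoment_odd (k : ℕ) :
    logArctanMoment (2 * k + 1)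
      = (∑ j ∈ Finset.Icc 1 k, (-1) ^ (j + 1) / (64 * ((k : ℝ) + 1 - (j : ℝ)) ^ 2) *
            (-(4 * Real.pi)
              + 4 * polygamma 0 ((2 * (k : ℝ) + 5 - 2 * (j : ℝ)) / 4)
              - 4 * polygamma 0 ((2 * (k : ℝ) + 3 - 2 * (j : ℝ)) / 4)
              - 2 * ((k : ℝ) + 1 - (j : ℝ)) *
                (polygamma 1 ((2 * (k : ℝ) + 5 - 2 * (j : ℝ)) / 4)
                  - polygamma 1 ((2 * (k : ℝ) + 3 - 2 * (j : ℝ)) / 4))))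
          + (-1) ^ k / 96 *
            (3 * Real.pi ^ 3 + 6 * Real.pi * Real.log 2 ^ 2 - 192 * W3) := by
  rw [eq_sum_of_add_two_eq_sub logArctanMoment_add_two, logArctanMoment_one]
  congr 1
  · refine Finset.sum_congr rfl fun j hj => ?_
    have hj := (Finset.mem_Icc.1 hj).2
    rw [integral_pow_mul_log_mul_arctan, Nat.cast_sub (by omega)]
    push_cast
    rw [show 2 * (k : ℝ) + 1 - 2 * j + 4 = 2 * k + 5 - 2 * j by ring,
      show 2 * (k : ℝ) + 1 - 2 * j + 2 = 2 * k + 3 - 2 * j by ring,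
      show 2 * (k : ℝ) + 1 - 2 * j + 1 = 2 * (k + 1 - j) by ring]
    ring
  · ring

theorem logArctanMoment_even (k : ℕ) :
    logArctanMoment (2 * k + 2)
      = (∑ j ∈ Finset.Icc 1 (k + 1),
            (-1) ^ (j + 1) / (16 * (2 * (k : ℝ) + 3 - 2 * (j : ℝ)) ^ 2) *
            (-(4 * Real.pi)
              + 4 * polygamma 0 (((k : ℝ) + 3 - (j : ℝ)) / 2)
              - 4 * polygamma 0 (((k : ℝ) + 2 - (j : ℝ)) / 2)
              - (2 * (k : ℝ) + 3 - 2 * (j : ℝ)) *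
                (polygamma 1 (((k : ℝ) + 3 - (j : ℝ)) / 2)
                  - polygamma 1 (((k : ℝ) + 2 - (j : ℝ)) / 2))))
          + (-1) ^ (k + 1) / 16 * (-(4 * catalanG * Real.pi) + 7 * zeta3) := by
  have h := eq_sum_of_add_two_eq_sub logArctanMoment_add_two 0 (k + 1)
  rw [logArctanMoment_zero] at h
  refine h.trans (congrArg₂ _ ?_ (by ring))
  refine Finset.sum_congr rfl fun j hj => ?_
  have hj := (Finset.mem_Icc.1 hj).2
  rw [integral_pow_mul_log_mul_arctan, Nat.cast_sub (by omega)]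
  push_cast
  rw [show (2 * ((k : ℝ) + 1) + 0 - 2 * j + 4) / 4 = (k + 3 - j) / 2 by ring,
    show (2 * ((k : ℝ) + 1) + 0 - 2 * j + 2) / 4 = (k + 2 - j) / 2 by ring,
    show 2 * ((k : ℝ) + 1) + 0 - 2 * j + 1 = 2 * k + 3 - 2 * j by ring]
  ring

/-- The first sum over `j` in the closed form is four times the last one, so its whole bracket
equals `π²/8 - 4A` with `A = A(2k+1)`. Then `2A - 4kA/(2k+1) = 2A/(2k+1)`, and the `π²` terms merge
into `-π²/(16(2k+1))`, as integration by parts demands. -/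
theorem closedFormOdd_eq_integral (k : ℕ) :
    closedFormOdd k = ∫ x in (0 : ℝ)..1, x ^ (2 * k) * Real.arctan x ^ 2 * Real.log x := by
  have hk : 2 * (k : ℝ) + 1 ≠ 0 := by positivity
  have hs : ∑ j ∈ Finset.Icc 1 k, (-1) ^ (j + 1) *
        ((Real.pi + harmonicReal ((2 * (k : ℝ) - 2 * (j : ℝ) - 1) / 4)
          - harmonicReal ((2 * (k : ℝ) - 2 * (j : ℝ) + 1) / 4)) / (2 + 2 * (k : ℝ) - 2 * (j : ℝ)))
      = 4 * (arctanMoment (2 * k + 1)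
        - (-1) ^ k / 8 * (4 * catalanG - Real.pi * Real.log 2)) := by
    rw [arctanMoment_odd, add_sub_cancel_right, Finset.mul_sum]
    refine Finset.sum_congr rfl fun j _ => ?_
    rw [show 2 * (k : ℝ) - 2 * j - 1 = 2 * k - 1 - 2 * j by ring,
      show 2 * (k : ℝ) - 2 * j + 1 = 2 * k + 1 - 2 * j by ring,
      show 2 + 2 * (k : ℝ) - 2 * j = 2 * (k + 1 - j) by ring]
    generalize (k : ℝ) + 1 - j = d
    ring
  rw [closedFormOdd, ← arctanMoment_odd, ← logArctanMoment_odd, hs,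
    integral_pow_mul_log_mul_arctan_sq]
  push_cast
  field_simp
  ring

theorem closedFormEven_eq_integral (k : ℕ) :
    closedFormEven k = ∫ x in (0 : ℝ)..1, x ^ (2 * k + 1) * Real.arctan x ^ 2 * Real.log x := by
  have hk : (k : ℝ) + 1 ≠ 0 := by positivity
  have hs : ∑ j ∈ Finset.Icc 1 (k + 1), (-1) ^ (j + 1) *
        ((Real.pi + harmonicReal (((k : ℝ) - (j : ℝ)) / 2)
          - harmonicReal (((k : ℝ) - (j : ℝ) + 1) / 2)) / (2 * (k : ℝ) - 2 * (j : ℝ) + 3))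
      = 4 * (arctanMoment (2 * k + 2) - (-1) ^ (k + 1) * Real.pi ^ 2 / 32) := by
    rw [arctanMoment_even, add_sub_cancel_right, Finset.mul_sum]
    refine Finset.sum_congr rfl fun j _ => ?_
    rw [show (k : ℝ) - j + 1 = k + 1 - j by ring,
      show 2 * (k : ℝ) - 2 * j + 3 = 2 * k + 3 - 2 * j by ring]
    generalize 2 * (k : ℝ) + 3 - 2 * j = d
    ring
  rw [closedFormEven, ← arctanMoment_even, ← logArctanMoment_even, hs,
    integral_pow_mul_log_mul_arctan_sq]
  push_cast
  rw [show 2 * (k : ℝ) + 1 + 1 = 2 * (k + 1) by ring]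
  field_simp
  ring

/-! ### Reindexing to the series as stated, and the theorem. -/

theorem milgram_one (n : ℕ) : milgram 1 n = 2 * oddHarmonic (n + 1) := by
  rw [oddHarmonic_eq_sum_range, Finset.mul_sum, milgram]
  refine Finset.sum_congr rfl fun m _ => ?_
  rw [milgram]
  push_cast
  field_simp
  ring

theorem hasSum_oddHarmonic_pnat {c : ℝ} {S : ℝ} (m : ℕ) (hc : c = m + 1)
    (hS : S = ∫ x in (0 : ℝ)..1, x ^ m * Real.arctan x ^ 2 * Real.log x) :
    HasSum (fun n : ℕ+ => (-1 : ℝ) ^ (n : ℕ) * oddHarmonic n /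
      ((n : ℝ) * (2 * (n : ℝ) + c) ^ 2)) S := by
  rw [← Equiv.pnatEquivNat.symm.hasSum_iff]
  refine (hasSum_oddHarmonic_moment m).of_eq (fun n => ?_) hS
  simp [hc, add_assoc]

theorem hasSum_milgram {c : ℝ} {S : ℝ} (m : ℕ) (hc : c = m + 3)
    (hS : S = ∫ x in (0 : ℝ)..1, x ^ m * Real.arctan x ^ 2 * Real.log x) :
    HasSum (fun n : ℕ => (-1 : ℝ) ^ (n + 1) * milgram 1 n /
      (2 * ((n : ℝ) + 1) * (2 * (n : ℝ) + c) ^ 2)) S := by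
  refine (hasSum_oddHarmonic_moment m).of_eq (fun n => ?_) hS
  rw [milgram_one, hc, show 2 * (n : ℝ) + (m + 3) = 2 * (n + 1) + m + 1 by ring]
  have : (n : ℝ) + 1 ≠ 0 := by positivity
  have : 2 * ((n : ℝ) + 1) + m + 1 ≠ 0 := by positivity
  field_simp

end EulerLike

theorem theorem3p3 (k : ℕ) :
    (HasSum (fun n : ℕ+ => (-1 : ℝ) ^ (n : ℕ) * EulerLike.oddHarmonic n /
          ((n : ℝ) * (2 * (n : ℝ) + 2 * (k : ℝ) + 1) ^ 2))
        (EulerLike.closedFormOdd k) ∧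
      HasSum (fun n : ℕ => (-1 : ℝ) ^ (n + 1) * EulerLike.milgram 1 n /
          (2 * ((n : ℝ) + 1) * (2 * (n : ℝ) + 2 * (k : ℝ) + 3) ^ 2))
        (EulerLike.closedFormOdd k)) ∧
    (HasSum (fun n : ℕ+ => (-1 : ℝ) ^ (n : ℕ) * EulerLike.oddHarmonic n /
          ((n : ℝ) * (2 * (n : ℝ) + 2 * (k : ℝ) + 2) ^ 2))
        (EulerLike.closedFormEven k) ∧
      HasSum (fun n : ℕ => (-1 : ℝ) ^ (n + 1) * EulerLike.milgram 1 n /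
          (2 * ((n : ℝ) + 1) * (2 * (n : ℝ) + 2 * (k : ℝ) + 4) ^ 2))
        (EulerLike.closedFormEven k)) := by
  have ho := EulerLike.closedFormOdd_eq_integral k
  have he := EulerLike.closedFormEven_eq_integral k
  -- Groups the denominators as `2n + c` with `c` free of `n`.
  simp only [add_assoc (2 * ((_ : ℕ) : ℝ))]
  refine ⟨⟨EulerLike.hasSum_oddHarmonic_pnat (2 * k) (by push_cast; ring) ho,
    EulerLike.hasSum_milgram (2 * k) (by push_cast; ring) ho⟩,
    EulerLike.hasSum_oddHarmonic_pnat (2 * k + 1) (by push_cast; ring) he,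
    EulerLike.hasSum_milgram (2 * k + 1) (by push_cast; ring) he⟩
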